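/- Let $\alpha>0$ and $\mathbb{C}^+=\{z\in\mathbb{C}:\operatorname{Re}z>0\}$. Let $H_2(\mathbb{C}^+)$ be the Hardy space of holomorphic functions $F$ on $\mathbb{C}^+$ with $$\|F\|_2:=\sup_{x>0}\Big(\frac1{2\pi}\int_{-\infty}^\infty|F(x+iy)|^2\,dy\Big)^{1/2}<\infty,$$ and for $F\in H_2(\mathbb{C}^+)$ put $$\mathfrak{C}_\alpha^*F(z):=\alpha\int_0^\infty(1-e^{-t})^{\alpha-1}F(e^{t}z)\,dt,\qquad z\in\mathbb{C}^+.$$ The operator $\mathfrak{C}_\alpha^*$ is injective on $H_2(\mathbb{C}^+)$. Let $H_2^{(\alpha)}(\mathbb{C}^+):=\mathfrak{C}_\alpha^*(H_2(\mathbb{C}^+))$, with norm $\|F\|_{2,(\alpha)}:=\Gamma(\alpha+1)\,\|(\mathfrak{C}_\alpha^*)^{-1}F\|_2$. **Theorem.** $H_2^{(\alpha)}(\mathbb{C}^+)$ is a reproducing kernel Hilbert space. Its reproducing kernel $K_\alpha$ satisfies the following estimates for every $z=|z|e^{i\theta}\in\mathbb{C}^+$, $\theta\in(-\pi/2,\pi/2)$.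 (i) If $\alpha\ge1$, then $$\frac{1}{(2\alpha-1)\Gamma(\alpha)^2}\,\frac1{|z|}\le\|K_\alpha(\cdot,z)\|_{2,(\alpha)}^2\le\frac{\pi}{\alpha\,\Gamma(\alpha)^2}\,\frac1{|z|}.$$ (ii) If $1/2<\alpha<1$, then $$\frac{1}{\Gamma(\alpha)^2}\,\frac1{|z|}\le\|K_\alpha(\cdot,z)\|_{2,(\alpha)}^2\le\frac{\pi}{(2\alpha-1)\Gamma(\alpha)^2}\,\frac1{|z|}.$$ Thus for every $\alpha>1/2$ there are constants $c,C>0$ such that $c\,|z|^{-1/2}\le\|K_\alpha(\cdot,z)\|_{2,(\alpha)}\le C\,|z|^{-1/2}$ for all $z\in\mathbb{C}^+$. (iii) If $0<\alpha\le1/2$, then $$\frac{1}{\Gamma(\alpha)^2}\,\frac1{|z|}\le\|K_\alpha(\cdot,z)\|_{2,(\alpha)}^2\le\frac{2}{\Gamma(\alpha+1)^2}\,\frac1{|z|}\quad\text{if }|\theta|\le\pi/4,$$ and $$\frac{1}{\Gamma(\alpha)^2}\,\frac1{|z|}\le\|K_\alpha(\cdot,z)\|_{2,(\alpha)}^2\le\frac{2}{\Gamma(\alpha+1)^2}\,\frac1{\operatorname{Re}z}\quad\text{if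 }\pi/4<|\theta|<\pi/2.$$ -/

import Mathlib

open MeasureTheory

noncomputable section

/-- The open right half-plane `ℂ⁺ = {z : Re z > 0}`. -/
abbrev RightHalfPlane : Type := {z : ℂ // 0 < z.re}

namespace RightHalfPlane

/-- A function on `ℂ⁺`, viewed as a function on `ℂ` (with value `0` off `ℂ⁺`). -/
def ext (F : RightHalfPlane → ℂ) : ℂ → ℂ := Function.extend Subtype.val F 0

/-- Dilation: `exp t * z` as a point of `ℂ⁺`. -/
def dilate (t : ℝ) (z : RightHalfPlane) : RightHalfPlane :=
  ⟨(Real.exp t : ℂ) * z.1, by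
    rw [Complex.re_ofReal_mul]
    exact mul_pos (Real.exp_pos t) z.2⟩

/-- The Hardy norm, with values in `[0, ∞]`:
`‖F‖₂ = sup_{x > 0} ((1 / 2π) ∫ |F(x + iy)|² dy)^{1/2}`. -/
def hardyNorm (F : RightHalfPlane → ℂ) : ENNReal :=
  ⨆ (x : ℝ) (_ : 0 < x),
    (ENNReal.ofReal (1 / (2 * Real.pi)) *
      ∫⁻ y : ℝ, ‖ext F ((x : ℂ) + (y : ℂ) * Complex.I)‖ₑ ^ 2) ^ (1 / 2 : ℝ)

/-- The Hardy space `H₂(ℂ⁺)`: holomorphic functions on `ℂ⁺` with finite Hardy norm. -/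
def hardySpace : Set (RightHalfPlane → ℂ) :=
  {F | DifferentiableOn ℂ (ext F) {z : ℂ | 0 < z.re} ∧ hardyNorm F < ⊤}

/-- The group `T₂(t) F(z) = e^{-t/2} F(e^{-t} z)`. -/
def isometryGroup (t : ℝ) (F : RightHalfPlane → ℂ) : RightHalfPlane → ℂ :=
  fun z => (Real.exp (-t / 2) : ℂ) * F (dilate (-t) z)

/-- The density `φ_α(t) = α (1 - e^{-t})^{α-1} e^{-t/2}`, `t > 0`. -/
def cesaroDensity (α t : ℝ) : ℝ :=
  α * (1 - Real.exp (-t)) ^ (α - 1) * Real.exp (-t / 2)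

/-- The complex Cesàro-Hardy operator `C*_α F = ∫₀^∞ φ_α(t) T₂(-t) F dt`, evaluated pointwise
(point evaluations are continuous on `H₂(ℂ⁺)`, so for `F` in `H₂(ℂ⁺)` these are the values of
the vector-valued integral). -/
def cesaroStar (α : ℝ) (F : RightHalfPlane → ℂ) : RightHalfPlane → ℂ :=
  fun z => ∫ t in Set.Ioi (0 : ℝ), (cesaroDensity α t : ℂ) * isometryGroup (-t) F z

/-- The Hardy-Sobolev space `H₂^{(α)}(ℂ⁺) = C*_α (H₂(ℂ⁺))`. -/
def hardySobolev (α : ℝ) : Set (RightHalfPlane → ℂ) :=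
  cesaroStar α '' hardySpace

/-- The norm `‖F‖_{2,(α)} = Γ(α+1) ‖(C*_α)⁻¹ F‖₂` of `H₂^{(α)}(ℂ⁺)`, where `(C*_α)⁻¹` is the
inverse of `C*_α` restricted to `H₂(ℂ⁺)`. -/
def hardySobolevNorm (α : ℝ) (F : RightHalfPlane → ℂ) : ℝ :=
  Real.Gamma (α + 1) *
    (hardyNorm (Function.invFunOn (cesaroStar α) hardySpace F)).toReal

/-- The reproducing kernel Hilbert space `H` is `H₂^{(α)}(ℂ⁺)`: its elements are exactly the
functions of `H₂^{(α)}(ℂ⁺)`, and its norm is `‖·‖_{2,(α)}`. The inner product is then determined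
by polarization, and so is the reproducing kernel. -/
structure IsHardySobolev (α : ℝ) (H : Type*) [NormedAddCommGroup H] [InnerProductSpace ℂ H]
    [RKHS ℂ H RightHalfPlane ℂ] : Prop where
  range_coe : Set.range (fun f : H => (f : RightHalfPlane → ℂ)) = hardySobolev α
  norm_eq : ∀ f : H, ‖f‖ = hardySobolevNorm α f

/-- The function `K_α(·, z) = K_{α,z}`, an element of `H`: for every `f` in `H`,
`⟪K_{α,z}, f⟫ = f(z)` with the inner product linear in `f`. -/
abbrev kernelAt (H : Type*) [NormedAddCommGroup H] [InnerProductSpace ℂ H] [CompleteSpace H]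
    [RKHS ℂ H RightHalfPlane ℂ] (z : RightHalfPlane) : H :=
  RKHS.kerFun H z (1 : ℂ)

end RightHalfPlane

end

/-! The Laplace transform `L` carries L²(0,∞) isometrically onto H₂(ℂ⁺), so every question moves to
L²(0,∞). With v = e^{-t} the operator becomes C*_α F(z) = ∫ v⁻¹ F(z/v) dμ(v), where μ has density
α(1-v)^{α-1} on (0,1). Hence C*_α(L g)(z) is the integral of g against k_z(s) = ∫ v⁻¹ e^{-zs/v}
dμ(v). Once k_z is known to be in L² and g ↦ C*_α(L g) to be injective, H₂^{(α)} is a copy of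
L²(0,∞) with continuous evaluations, and ‖K_α(·,z)‖ = ‖k_z‖ / Γ(α+1).

Expanding the square gives ‖k_z‖² = ∬ P(v,w) dμ(v) dμ(w) with P(v,w) = Re (wz + v z̄)⁻¹, symmetric
and homogeneous of degree -1 (`eLpNorm_cesaroKernel_sq`). All the estimates concern this double
integral: - α > 1/2, upper: a Schur test with weight v^{-1/2}. The constant ∫₀^∞ P(v,w) √(v/w) dw =
π/|z| is exact, and the density has squared L² norm α²/(2α-1). - lower: by symmetry the region w < v
counts twice, and ∫₀^v P(v,w) dw does not depend on v and is at least 1/(2|z|). Monotonicity of the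
density bounds the product of the two weights from below. - α ≤ 1, upper: P ≤ 1/((v+w) Re z). The
density increases while 1/(v+w) decreases, so Chebyshev's inequality replaces μ by Lebesgue measure,
leaving 2 log 2 / Re z. In the sector |θ| ≤ π/4 the inequality √2 log 2 < 1 turns Re z into |z|.

Surjectivity of `L` (`exists_laplace_eq`) avoids boundary values: Cauchy's formula on a vertical
line and Plancherel bound |∑ c_z F(z)| by ‖F‖₂ times the L² norm of ∑ c_z e^{-zs}, and Hahn–Banach
with Riesz supplies g. For injectivity, C*_α L g is the Laplace transform of s ↦ ∫ g(vs) dμ(v). If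
this average vanishes, testing it against s^α e^{-xs} gives a nonzero multiple of L g(x), so L g =
0. -/

/-! ### Plancherel for functions in L¹ ∩ L² -/

open FourierTransform SchwartzMap in
theorem integral_smul_fourier_eq_of_integrable {f : ℝ → ℂ} (hf : Integrable f) (g : 𝓢(ℝ, ℂ)) :
    ∫ x, g x • 𝓕 f x = ∫ x, (𝓕 g) x • f x := by
  have h := VectorFourier.integral_fourierIntegral_smul_eq_flip (L := innerₗ ℝ)
    Real.continuous_fourierChar continuous_inner g.integrable hf (μ := volume) (ν := volume)
  rw [flip_innerₗ] at h
  exact h.symm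

open FourierTransform SchwartzMap ContDiff in
theorem ae_eq_of_integral_schwartz_smul_eq {f g : ℝ → ℂ} (hf : LocallyIntegrable f)
    (hg : LocallyIntegrable g) (h : ∀ φ : 𝓢(ℝ, ℂ), ∫ x, φ x • f x = ∫ x, φ x • g x) :
    f =ᵐ[volume] g := by
  refine ae_eq_of_integral_contDiff_smul_eq hf hg fun φ hφ hc => ?_
  have h₁ : HasCompactSupport (Complex.ofRealCLM ∘ φ) := hc.comp_left rfl
  have h₂ : ContDiff ℝ ∞ (Complex.ofRealCLM ∘ φ) := by fun_prop
  simpa using h (h₁.toSchwartzMap h₂)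

open FourierTransform in
theorem locallyIntegrable_fourier {f : ℝ → ℂ} (hf : Integrable f) :
    LocallyIntegrable (𝓕 f) :=
  (VectorFourier.fourierIntegral_continuous (L := innerₗ ℝ) Real.continuous_fourierChar
    continuous_inner hf).locallyIntegrable

open FourierTransform SchwartzMap in
-- Every Schwartz function is the Fourier transform of a Schwartz function, so the multiplication
-- formula makes f annihilate all test functions.
theorem ae_eq_zero_of_fourier_eq_zero {f : ℝ → ℂ} (hf : Integrable f) (h : ∀ ξ, 𝓕 f ξ = 0) :
    f =ᵐ[volume] 0 := by
  refine ae_eq_of_integral_schwartz_smul_eq hf.locallyIntegrable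
    (locallyIntegrable_zero) fun φ => ?_
  have := integral_smul_fourier_eq_of_integrable hf (𝓕⁻ φ)
  simp only [h, FourierTransform.fourier_fourierInv_eq] at this
  simpa using this.symm

open FourierTransform SchwartzMap in
-- The L² transform and the integral transform define the same tempered distribution. This makes the
-- abstract isometry on L² available for explicit integrals.
theorem fourier_toLp_ae_eq {f : ℝ → ℂ} (h₁ : Integrable f) (h₂ : MemLp f 2) :
    ((𝓕 (h₂.toLp f) : Lp ℂ 2) : ℝ → ℂ) =ᵐ[volume] 𝓕 f := by
  refine ae_eq_of_integral_schwartz_smul_eq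
    ((Lp.memLp _).locallyIntegrable (by norm_num)) (locallyIntegrable_fourier h₁) fun φ => ?_
  have h := congrArg (fun T : 𝓢'(ℝ, ℂ) => T φ)
    (MeasureTheory.Lp.fourier_toTemperedDistribution_eq (h₂.toLp f))
  simp only [TemperedDistribution.fourier_apply, Lp.toTemperedDistribution_apply] at h
  rw [← h, integral_smul_fourier_eq_of_integrable h₁]
  refine integral_congr_ae ?_
  filter_upwards [h₂.coeFn_toLp] with x hx
  rw [hx]

theorem eLpNorm_two_sq {X : Type*} [MeasurableSpace X] (μ : Measure X) (f : X → ℂ) :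
    eLpNorm f 2 μ ^ 2 = ∫⁻ x, ‖f x‖ₑ ^ 2 ∂μ := by
  have := eLpNorm_nnreal_pow_eq_lintegral (p := 2) (f := f) (μ := μ) (by norm_num)
  simp only [NNReal.coe_ofNat, ENNReal.rpow_ofNat, ENNReal.coe_ofNat] at this
  exact this

open FourierTransform in
theorem lintegral_enorm_sq_fourier {f : ℝ → ℂ} (h₁ : Integrable f) (h₂ : MemLp f 2) :
    ∫⁻ ξ, ‖𝓕 f ξ‖ₑ ^ 2 = ∫⁻ x, ‖f x‖ₑ ^ 2 := by
  have h : eLpNorm (𝓕 f) 2 volume = eLpNorm f 2 volume := by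
    rw [← eLpNorm_congr_ae (fourier_toLp_ae_eq h₁ h₂), ← eLpNorm_congr_ae h₂.coeFn_toLp]
    have := MeasureTheory.Lp.norm_fourier_eq (h₂.toLp f)
    rw [Lp.norm_def, Lp.norm_def] at this
    exact (ENNReal.toReal_eq_toReal_iff' (Lp.eLpNorm_ne_top _) (Lp.eLpNorm_ne_top _)).1 this
  rw [← eLpNorm_two_sq, ← eLpNorm_two_sq, h]

theorem lintegral_comp_mul_left_real {a : ℝ} (ha : a ≠ 0) (f : ℝ → ENNReal) :
    ∫⁻ x, f (a * x) = ENNReal.ofReal |a⁻¹| * ∫⁻ x, f x := by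
  rw [← smul_eq_mul, ← lintegral_smul_measure, ← Real.map_volume_mul_left ha]
  exact (lintegral_map_equiv f (Homeomorph.mulLeft₀ a ha).toMeasurableEquiv).symm

/-- Plancherel on the half-line, in the normalization of the Laplace transform. -/
theorem lintegral_enorm_sq_integral_exp {f : ℝ → ℂ}
    (h₁ : IntegrableOn f (Set.Ioi 0)) (h₂ : MemLp f 2 (volume.restrict (Set.Ioi 0))) :
    ∫⁻ y : ℝ, ‖∫ s in Set.Ioi (0 : ℝ), Complex.exp (-((y : ℂ) * Complex.I) * s) * f s‖ₑ ^ 2 =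
      ENNReal.ofReal (2 * Real.pi) * ∫⁻ s in Set.Ioi (0 : ℝ), ‖f s‖ₑ ^ 2 := by
  set F := (Set.Ioi (0 : ℝ)).indicator f with hF
  have i₁ : Integrable F := (integrable_indicator_iff measurableSet_Ioi).2 h₁
  have i₂ : MemLp F 2 := (memLp_indicator_iff_restrict measurableSet_Ioi).2 h₂
  have key := lintegral_enorm_sq_fourier i₁ i₂
  have e₂ : ∫⁻ x, ‖F x‖ₑ ^ 2 = ∫⁻ s in Set.Ioi (0 : ℝ), ‖f s‖ₑ ^ 2 := by
    rw [← lintegral_indicator measurableSet_Ioi]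
    congr 1 with x
    by_cases hx : x ∈ Set.Ioi (0 : ℝ) <;> simp [hF, hx]
  set G : ℝ → ℂ := fun y => ∫ s in Set.Ioi (0 : ℝ),
    Complex.exp (-((y : ℂ) * Complex.I) * s) * f s with hG
  have e₁ : ∀ ξ : ℝ, FourierTransform.fourier F ξ = G (2 * Real.pi * ξ) := fun ξ => by
    simp only [Real.fourier_eq', hG]
    rw [← integral_indicator measurableSet_Ioi]
    congr 1 with x
    by_cases hx : x ∈ Set.Ioi (0 : ℝ)
    · simp only [hF, hx, Set.indicator_of_mem, smul_eq_mul]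
      congr 2
      simp
      ring
    · simp [hF, hx]
  rw [← e₂, ← key]
  simp_rw [e₁]
  rw [lintegral_comp_mul_left_real Real.two_pi_pos.ne' (fun y => ‖G y‖ₑ ^ 2), ← mul_assoc,
    ← ENNReal.ofReal_mul Real.two_pi_pos.le, abs_of_pos (inv_pos.2 Real.two_pi_pos),
    mul_inv_cancel₀ Real.two_pi_pos.ne', ENNReal.ofReal_one, one_mul]

/-! ### The Laplace transform as an isometry of L²(0,∞) into H₂ -/

/-- Lebesgue measure on `(0, ∞)`. -/
noncomputable abbrev halfLine : Measure ℝ := volume.restrict (Set.Ioi 0)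

/-- The Laplace transform `∫₀^∞ e^{-zs} g(s) ds`. -/
noncomputable def laplace (g : ℝ → ℂ) (z : ℂ) : ℂ :=
  ∫ s, Complex.exp (-z * s) * g s ∂halfLine

theorem norm_exp_neg_mul (z : ℂ) (s : ℝ) : ‖Complex.exp (-z * s)‖ = Real.exp (-(z.re * s)) := by
  simp [Complex.norm_exp]

theorem memLp_exp_neg_mul {z : ℂ} (hz : 0 < z.re) :
    MemLp (fun s : ℝ => Complex.exp (-z * s)) 2 halfLine := by
  rw [memLp_two_iff_integrable_sq_norm (by fun_prop)]
  have h := integrableOn_exp_mul_Ioi (a := -(2 * z.re)) (by linarith) 0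
  refine h.congr_fun (fun s _ => ?_) measurableSet_Ioi
  simp only [norm_exp_neg_mul, ← Real.exp_nat_mul]
  congr 1
  push_cast
  ring

theorem integrable_exp_neg_mul_mul {g : ℝ → ℂ} (hg : MemLp g 2 halfLine) {z : ℂ}
    (hz : 0 < z.re) : Integrable (fun s : ℝ => Complex.exp (-z * s) * g s) halfLine :=
  (memLp_exp_neg_mul hz).integrable_mul hg

theorem memLp_exp_neg_mul_mul {g : ℝ → ℂ} (hg : MemLp g 2 halfLine) {z : ℂ}
    (hz : 0 ≤ z.re) : MemLp (fun s : ℝ => Complex.exp (-z * s) * g s) 2 halfLine := by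
  have hm : AEStronglyMeasurable (fun s : ℝ => Complex.exp (-z * s)) halfLine := by fun_prop
  refine hg.of_le (hm.mul hg.1) ?_
  filter_upwards [ae_restrict_mem measurableSet_Ioi] with s (hs : 0 < s)
  rw [norm_mul, norm_exp_neg_mul]
  exact mul_le_of_le_one_left (norm_nonneg _) (Real.exp_le_one_iff.2 (by nlinarith))

theorem laplace_congr_ae {f g : ℝ → ℂ} (h : f =ᵐ[halfLine] g) : laplace f = laplace g := by
  funext z
  refine integral_congr_ae ?_
  filter_upwards [h] with s hs
  rw [hs]

theorem differentiableAt_laplace {g : ℝ → ℂ} (hg : MemLp g 2 halfLine) {z : ℂ}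
    (hz : 0 < z.re) : DifferentiableAt ℂ (laplace g) z := by
  set a := z.re / 2 with ha
  have ha0 : 0 < a := by positivity
  have hm : ∀ w : ℂ, AEStronglyMeasurable (fun s : ℝ => Complex.exp (-w * s) * g s) halfLine :=
    fun w => (show Continuous fun s : ℝ => Complex.exp (-w * s) by
      fun_prop).aestronglyMeasurable.mul hg.1
  have hb : Integrable (fun s : ℝ => (2 / a) * ‖Complex.exp (-((a / 2 : ℝ) : ℂ) * s) * g s‖)
      halfLine :=
    (integrable_exp_neg_mul_mul hg (z := ((a / 2 : ℝ) : ℂ)) (by simpa using ha0)).norm.const_mul _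
  refine (hasDerivAt_integral_of_dominated_loc_of_deriv_le
    (F' := fun w s => (-(s : ℂ)) * (Complex.exp (-w * s) * g s))
    (s := {w : ℂ | a < w.re}) ?_ (Filter.Eventually.of_forall hm)
    (integrable_exp_neg_mul_mul hg hz) ?_ ?_ hb ?_).2.differentiableAt
  · exact (isOpen_lt continuous_const Complex.continuous_re).mem_nhds
      (show a < z.re by rw [ha]; linarith)
  · exact (show Continuous fun s : ℝ => -(s : ℂ) by fun_prop).aestronglyMeasurable.mul (hm z)
  · filter_upwards [ae_restrict_mem measurableSet_Ioi] with s (hs : 0 < s) w (hw : a < w.re)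
    rw [norm_mul, norm_mul, norm_mul, norm_exp_neg_mul, norm_exp_neg_mul, ← mul_assoc, ← mul_assoc]
    refine mul_le_mul_of_nonneg_right ?_ (norm_nonneg _)
    -- Half of the decay e^{-as} is spent on absorbing the factor s produced by differentiation; the
    -- other half keeps the majorant integrable against an L² function.
    have h1 : s ≤ 2 / a * Real.exp (a / 2 * s) := by
      have := Real.add_one_le_exp (a / 2 * s)
      rw [div_mul_eq_mul_div, le_div_iff₀ ha0]
      linarith
    have h2 : Real.exp (-(w.re * s)) ≤ Real.exp (-(a * s)) := by
      apply Real.exp_le_exp.2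
      nlinarith
    have h3 : Real.exp (a / 2 * s) * Real.exp (-(a * s)) = Real.exp (-(a / 2 * s)) := by
      rw [← Real.exp_add]
      congr 1
      ring
    simp only [norm_neg, Complex.norm_real, Real.norm_of_nonneg hs.le, Complex.ofReal_re]
    calc s * Real.exp (-(w.re * s)) ≤ (2 / a * Real.exp (a / 2 * s)) * Real.exp (-(a * s)) := by
          gcongr
      _ = _ := by rw [mul_assoc, h3]
  · refine Filter.Eventually.of_forall fun s w _ => ?_
    have h1 : HasDerivAt (fun w : ℂ => -w * (s : ℂ)) (-(s : ℂ)) w := by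
      simpa using (hasDerivAt_id w).neg.mul_const (s : ℂ)
    convert! (h1.cexp.mul_const (g s)) using 1
    ring

theorem lintegral_enorm_sq_laplace {g : ℝ → ℂ} (hg : MemLp g 2 halfLine) {x : ℝ} (hx : 0 < x) :
    ∫⁻ y : ℝ, ‖laplace g ((x : ℂ) + (y : ℂ) * Complex.I)‖ₑ ^ 2 =
      ENNReal.ofReal (2 * Real.pi) *
        ∫⁻ s, ‖Complex.exp (-(x : ℂ) * s) * g s‖ₑ ^ 2 ∂halfLine := by
  rw [← lintegral_enorm_sq_integral_exp
    (integrable_exp_neg_mul_mul hg (z := (x : ℂ)) (by simpa using hx))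
    (memLp_exp_neg_mul_mul hg (z := (x : ℂ)) (by simpa using hx.le))]
  congr! 4 with y
  unfold laplace
  congr 1 with s
  rw [← mul_assoc, ← Complex.exp_add]
  congr 2
  ring

namespace RightHalfPlane

theorem ext_apply (F : RightHalfPlane → ℂ) {z : ℂ} (hz : 0 < z.re) : ext F z = F ⟨z, hz⟩ :=
  Subtype.val_injective.extend_apply F 0 ⟨z, hz⟩

/-- The Laplace transform as a function on the half-plane. -/
noncomputable def laplaceHalfPlane (g : ℝ → ℂ) : RightHalfPlane → ℂ := fun z => laplace g z

/-- By Plancherel the mean on the line Re = x is the L² norm of e^{-xs} g. Since e^{-xs} ≤ 1 this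
never exceeds ‖g‖, and Fatou along x = 1/(n+1) gives the reverse inequality. -/
theorem hardyNorm_laplace {g : ℝ → ℂ} (hg : MemLp g 2 halfLine) :
    hardyNorm (laplaceHalfPlane g) = eLpNorm g 2 halfLine := by
  have e : ∀ x : ℝ, 0 < x → (ENNReal.ofReal (1 / (2 * Real.pi)) *
      ∫⁻ y : ℝ, ‖ext (laplaceHalfPlane g) ((x : ℂ) + (y : ℂ) * Complex.I)‖ₑ ^ 2) ^ (1 / 2 : ℝ) =
      eLpNorm (fun s : ℝ => Complex.exp (-(x : ℂ) * s) * g s) 2 halfLine := fun x hx => by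
    have h1 : ∀ y : ℝ, ext (laplaceHalfPlane g) ((x : ℂ) + (y : ℂ) * Complex.I) =
        laplace g ((x : ℂ) + (y : ℂ) * Complex.I) := fun y => by
      rw [ext_apply _ (by simpa using hx)]
      rfl
    simp_rw [h1]
    rw [lintegral_enorm_sq_laplace hg hx, ← mul_assoc, ← ENNReal.ofReal_mul (by positivity),
      one_div_mul_cancel Real.two_pi_pos.ne', ENNReal.ofReal_one, one_mul, ← eLpNorm_two_sq,
      ← ENNReal.rpow_natCast, ← ENNReal.rpow_mul]
    norm_num
  refine le_antisymm (iSup₂_le fun x hx => ?_) ?_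
  · rw [e x hx]
    refine eLpNorm_mono_ae ?_
    filter_upwards [ae_restrict_mem measurableSet_Ioi] with s (hs : 0 < s)
    rw [norm_mul, norm_exp_neg_mul]
    refine mul_le_of_le_one_left (norm_nonneg _) (Real.exp_le_one_iff.2 ?_)
    simpa using (mul_pos hx hs).le
  · refine (Lp.eLpNorm_lim_le_liminf_eLpNorm
      (f := fun (n : ℕ) (s : ℝ) => Complex.exp (-((1 / ((n : ℝ) + 1) : ℝ) : ℂ) * s) * g s)
      (fun n => ?_) g ?_).trans ?_
    · exact (show Continuous fun s : ℝ => Complex.exp (-((1 / ((n : ℝ) + 1) : ℝ) : ℂ) * s) by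
        fun_prop).aestronglyMeasurable.mul hg.1
    · refine Filter.Eventually.of_forall fun s => ?_
      have h : Filter.Tendsto (fun n : ℕ => ((1 / ((n : ℝ) + 1) : ℝ) : ℂ)) Filter.atTop
          (nhds ((0 : ℝ) : ℂ)) :=
        (Complex.continuous_ofReal.tendsto 0).comp tendsto_one_div_add_atTop_nhds_zero_nat
      have h2 : Continuous fun t : ℂ => Complex.exp (-t * s) * g s := by fun_prop
      have h3 := (h2.tendsto _).comp h
      simpa [Function.comp_def] using h3
    · refine Filter.liminf_le_of_frequently_le' (Filter.Frequently.of_forall fun n => ?_)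
      have hn : (0 : ℝ) < 1 / ((n : ℝ) + 1) := by positivity
      rw [← e _ hn]
      exact le_iSup₂ (f := fun (x : ℝ) (_ : 0 < x) => (ENNReal.ofReal (1 / (2 * Real.pi)) *
        ∫⁻ y : ℝ, ‖ext (laplaceHalfPlane g) ((x : ℂ) + (y : ℂ) * Complex.I)‖ₑ ^ 2)
          ^ (1 / 2 : ℝ)) _ hn

theorem laplace_mem_hardySpace {g : ℝ → ℂ} (hg : MemLp g 2 halfLine) :
    laplaceHalfPlane g ∈ hardySpace := by
  refine ⟨fun z hz => ?_, by rw [hardyNorm_laplace hg]; exact hg.2⟩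
  refine ((differentiableAt_laplace hg hz).differentiableWithinAt).congr (fun w hw => ?_) ?_
  · rw [ext_apply _ hw]; rfl
  · rw [ext_apply _ hz]; rfl

end RightHalfPlane

/-! ### Pointwise growth of Hardy functions -/

/-- Sub-mean value property of `|f|²` on a disc. -/
theorem enorm_sq_mul_area_le_lintegral_ball {f : ℂ → ℂ} (hm : Measurable f) {c : ℂ} {ρ : ℝ}
    (hρ : 0 < ρ) (hf : DifferentiableOn ℂ f (Metric.ball c ρ)) :
    ENNReal.ofReal (Real.pi * ρ ^ 2) * ‖f c‖ₑ ^ 2 ≤ ∫⁻ w in Metric.ball c ρ, ‖f w‖ₑ ^ 2 := by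
  have mean : ∀ r : ℝ, 0 < r → r < ρ → ENNReal.ofReal (2 * Real.pi) * ‖f c‖ₑ ^ 2 ≤
      ∫⁻ θ in Set.Ioo (-Real.pi) Real.pi, ‖f (c + Complex.polarCoord.symm (r, θ))‖ₑ ^ 2 := by
    intro r hr hrρ
    -- The mean value property is applied to the holomorphic function f², which gives |f(c)|² ≤ mean
    -- of |f|² directly. The circle is parametrized over (-π, π) to match polar coordinates.
    have hd : DiffContOnCl ℂ (fun w => f w ^ 2) (Metric.ball c |r|) := by
      rw [abs_of_pos hr]
      exact (hf.pow 2).diffContOnCl_ball (Metric.closedBall_subset_ball hrρ)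
    have h := hd.circleAverage
    rw [Real.circleAverage_eq_integral_add (-Real.pi)] at h
    have h2 : ∫ θ in Set.Ioo (-Real.pi) Real.pi, f (c + Complex.polarCoord.symm (r, θ)) ^ 2 =
        (2 * Real.pi : ℝ) * f c ^ 2 := by
      rw [← h, ← integral_Ioc_eq_integral_Ioo, ← intervalIntegral.integral_of_le
        (by linarith [Real.pi_pos])]
      rw [intervalIntegral.integral_comp_add_right (fun θ => f (circleMap c r θ) ^ 2)]
      rw [Complex.real_smul, ← mul_assoc, ← Complex.ofReal_mul,
        mul_inv_cancel₀ Real.two_pi_pos.ne', Complex.ofReal_one, one_mul]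
      have e1 : 0 + -Real.pi = -Real.pi := by ring
      have e2 : 2 * Real.pi + -Real.pi = Real.pi := by ring
      rw [e1, e2]
      refine intervalIntegral.integral_congr fun θ _ => ?_
      simp [circleMap, Complex.exp_mul_I]
    have h3 := enorm_integral_le_lintegral_enorm
      (μ := volume.restrict (Set.Ioo (-Real.pi) Real.pi))
      (fun θ => f (c + Complex.polarCoord.symm (r, θ)) ^ 2)
    rw [h2, enorm_mul] at h3
    simp only [enorm_pow] at h3
    refine le_trans (le_of_eq ?_) h3
    rw [← ofReal_norm (((2 * Real.pi : ℝ) : ℂ)), Complex.norm_real,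
      Real.norm_of_nonneg Real.two_pi_pos.le]
  set h : ℂ → ENNReal := fun w => (Metric.ball (0 : ℂ) ρ).indicator (fun w => ‖f (c + w)‖ₑ ^ 2) w
    with hh
  have hmeas : Measurable h :=
    ((hm.comp (measurable_const_add c)).enorm.pow_const 2).indicator Metric.isOpen_ball.measurableSet
  have e1 : ∫⁻ w in Metric.ball c ρ, ‖f w‖ₑ ^ 2 = ∫⁻ w, h w := by
    rw [← lintegral_indicator Metric.isOpen_ball.measurableSet,
      ← lintegral_add_left_eq_self _ c]
    congr 1 with w
    by_cases hw : w ∈ Metric.ball (0 : ℂ) ρ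
    · have : c + w ∈ Metric.ball c ρ := by simpa [dist_eq_norm] using hw
      rw [hh, Set.indicator_of_mem this]
      simp only [Set.indicator_of_mem hw]
    · have : c + w ∉ Metric.ball c ρ := by simpa [dist_eq_norm] using hw
      rw [hh, Set.indicator_of_notMem this]
      simp only [Set.indicator_of_notMem hw]
  rw [e1, ← Complex.lintegral_comp_polarCoord_symm]
  have hps : Measurable fun p : ℝ × ℝ => Complex.polarCoord.symm p := by
    simp only [Complex.polarCoord_symm_apply]
    fun_prop
  have e2 : ∫⁻ p in polarCoord.target, ENNReal.ofReal p.1 • h (Complex.polarCoord.symm p) =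
      ∫⁻ r in Set.Ioi (0 : ℝ), ∫⁻ θ in Set.Ioo (-Real.pi) Real.pi,
        ENNReal.ofReal r * h (Complex.polarCoord.symm (r, θ)) := by
    have : polarCoord.target = Set.Ioi (0 : ℝ) ×ˢ Set.Ioo (-Real.pi) Real.pi := rfl
    rw [this, Measure.volume_eq_prod, ← Measure.prod_restrict, lintegral_prod]
    · rfl
    · exact ((ENNReal.measurable_ofReal.comp measurable_fst).mul (hmeas.comp hps)).aemeasurable
  rw [e2]
  have e3 : ∫⁻ r in Set.Ioo (0 : ℝ) ρ, ENNReal.ofReal r = ENNReal.ofReal (ρ ^ 2 / 2) := by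
    rw [← ofReal_integral_eq_lintegral_ofReal]
    · rw [← integral_Ioc_eq_integral_Ioo, ← intervalIntegral.integral_of_le hρ.le, integral_id]
      simp
    · exact (continuous_id.integrableOn_Icc (a := 0) (b := ρ)).mono_set Set.Ioo_subset_Icc_self
    · filter_upwards [ae_restrict_mem measurableSet_Ioo] with r hr using hr.1.le
  calc ENNReal.ofReal (Real.pi * ρ ^ 2) * ‖f c‖ₑ ^ 2
      = (∫⁻ r in Set.Ioo (0 : ℝ) ρ, ENNReal.ofReal r) *
          (ENNReal.ofReal (2 * Real.pi) * ‖f c‖ₑ ^ 2) := by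
        rw [e3, ← mul_assoc, ← ENNReal.ofReal_mul (by positivity)]
        congr 2
        ring
    _ = ∫⁻ r in Set.Ioo (0 : ℝ) ρ, ENNReal.ofReal r *
          (ENNReal.ofReal (2 * Real.pi) * ‖f c‖ₑ ^ 2) :=
        (lintegral_mul_const _ ENNReal.measurable_ofReal).symm
    _ ≤ ∫⁻ r in Set.Ioo (0 : ℝ) ρ, ∫⁻ θ in Set.Ioo (-Real.pi) Real.pi,
        ENNReal.ofReal r * h (Complex.polarCoord.symm (r, θ)) := by
        refine setLIntegral_mono' measurableSet_Ioo fun r hr => ?_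
        rw [lintegral_const_mul' _ _ ENNReal.ofReal_ne_top]
        refine mul_le_mul_right ((mean r hr.1 hr.2).trans (le_of_eq ?_)) _
        congr 1 with θ
        rw [hh]
        have : Complex.polarCoord.symm (r, θ) ∈ Metric.ball (0 : ℂ) ρ := by
          rw [mem_ball_zero_iff, Complex.norm_polarCoord_symm, abs_of_pos hr.1]
          exact hr.2
        simp only [Set.indicator_of_mem this]
    _ ≤ _ := lintegral_mono_set Set.Ioo_subset_Ioi_self

theorem lintegral_complex_eq (h : ℂ → ENNReal) (hm : Measurable h) :
    ∫⁻ w, h w = ∫⁻ x : ℝ, ∫⁻ y : ℝ, h ((x : ℂ) + (y : ℂ) * Complex.I) := by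
  rw [← Complex.volume_preserving_equiv_real_prod.symm.lintegral_comp_emb
    Complex.measurableEquivRealProd.symm.measurableEmbedding, Measure.volume_eq_prod,
    lintegral_prod (fun p => h (Complex.measurableEquivRealProd.symm p))
      (hm.comp Complex.measurableEquivRealProd.symm.measurable).aemeasurable]
  congr! 5 with x y
  exact Complex.mk_eq_add_mul_I _ _

namespace RightHalfPlane

theorem ext_of_notMem (F : RightHalfPlane → ℂ) {z : ℂ} (hz : ¬ 0 < z.re) : ext F z = 0 :=
  Function.extend_apply' _ _ _ fun ⟨a, ha⟩ => hz (ha ▸ a.2)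

theorem isOpen_re_pos : IsOpen {z : ℂ | 0 < z.re} := isOpen_lt continuous_const Complex.continuous_re

theorem measurable_ext {F : RightHalfPlane → ℂ}
    (hF : DifferentiableOn ℂ (ext F) {z : ℂ | 0 < z.re}) : Measurable (ext F) := by
  classical
  have := ContinuousOn.measurable_piecewise (f := ext F) (g := fun _ => 0) hF.continuousOn
    continuousOn_const isOpen_re_pos.measurableSet
  have e : ext F = {z : ℂ | 0 < z.re}.piecewise (ext F) fun _ => 0 := by
    funext z
    by_cases hz : 0 < z.re
    · exact (Set.piecewise_eq_of_mem {z : ℂ | 0 < z.re} _ _ hz).symm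
    · rw [ext_of_notMem F hz]
      exact (Set.piecewise_eq_of_notMem {z : ℂ | 0 < z.re} (ext F) (fun _ => 0) hz).symm
  rw [e]
  exact this

theorem lintegral_line_le_hardyNorm (F : RightHalfPlane → ℂ) {x : ℝ} (hx : 0 < x) :
    ∫⁻ y : ℝ, ‖ext F ((x : ℂ) + (y : ℂ) * Complex.I)‖ₑ ^ 2 ≤
      ENNReal.ofReal (2 * Real.pi) * hardyNorm F ^ 2 := by
  have h := le_iSup₂ (f := fun (x : ℝ) (_ : 0 < x) => (ENNReal.ofReal (1 / (2 * Real.pi)) *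
        ∫⁻ y : ℝ, ‖ext F ((x : ℂ) + (y : ℂ) * Complex.I)‖ₑ ^ 2) ^ (1 / 2 : ℝ)) x hx
  have h2 := pow_le_pow_left₀ (zero_le) h 2
  rw [← ENNReal.rpow_natCast, ← ENNReal.rpow_mul,
    show (1 / 2 : ℝ) * ((2 : ℕ) : ℝ) = 1 by norm_num, ENNReal.rpow_one] at h2
  change _ ≤ hardyNorm F ^ 2 at h2
  refine le_trans (le_of_eq ?_) (mul_le_mul_right h2 (ENNReal.ofReal (2 * Real.pi)))
  rw [← mul_assoc, ← ENNReal.ofReal_mul (by positivity),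
    show 2 * Real.pi * (1 / (2 * Real.pi)) = 1 by field_simp, ENNReal.ofReal_one, one_mul]

/-- The disc of radius Re z about z lies in the strip 0 < Re < 2 Re z, over which |F|² integrates to
at most 2 Re z · 2π‖F‖₂². Dividing by the area π (Re z)² gives the constant 4. -/
theorem norm_ext_sq_le {F : RightHalfPlane → ℂ} (hF : F ∈ hardySpace) {z : ℂ} (hz : 0 < z.re) :
    ‖ext F z‖ ^ 2 ≤ 4 * (hardyNorm F).toReal ^ 2 / z.re := by
  have hsub : Metric.ball z z.re ⊆ {w : ℂ | w.re ∈ Set.Ioo 0 (2 * z.re)} := fun w hw => by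
    have h1 : |(w - z).re| < z.re :=
      (Complex.abs_re_le_norm _).trans_lt (by simpa [dist_eq_norm] using hw)
    rw [Complex.sub_re, abs_lt] at h1
    exact ⟨by linarith, by linarith⟩
  have hms : MeasurableSet {w : ℂ | w.re ∈ Set.Ioo 0 (2 * z.re)} :=
    Complex.measurable_re measurableSet_Ioo
  have hm := measurable_ext hF.1
  have h1 := (enorm_sq_mul_area_le_lintegral_ball hm hz
    (hF.1.mono fun w hw => (hsub hw).1)).trans (lintegral_mono_set hsub)
  rw [← lintegral_indicator hms, lintegral_complex_eq _ ((hm.enorm.pow_const 2).indicator hms)] at h1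
  have h2 : ∀ x : ℝ, ∫⁻ y : ℝ, {w : ℂ | w.re ∈ Set.Ioo 0 (2 * z.re)}.indicator
      (fun w => ‖ext F w‖ₑ ^ 2) ((x : ℂ) + (y : ℂ) * Complex.I) ≤
      (Set.Ioo 0 (2 * z.re)).indicator
        (fun _ => ENNReal.ofReal (2 * Real.pi) * hardyNorm F ^ 2) x := fun x => by
    by_cases hx : x ∈ Set.Ioo 0 (2 * z.re)
    · rw [Set.indicator_of_mem hx]
      exact (lintegral_mono fun y => Set.indicator_le_self _ _ _).trans
        (lintegral_line_le_hardyNorm F hx.1)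
    · rw [Set.indicator_of_notMem hx]
      refine (lintegral_eq_zero_of_ae_eq_zero (Filter.Eventually.of_forall fun y => ?_)).le
      refine Set.indicator_of_notMem ?_ _
      simpa using hx
  replace h1 := h1.trans (lintegral_mono h2)
  rw [lintegral_indicator measurableSet_Ioo, lintegral_const, Measure.restrict_apply_univ,
    Real.volume_Ioo, sub_zero] at h1
  have hfin : ENNReal.ofReal (2 * Real.pi) * hardyNorm F ^ 2 * ENNReal.ofReal (2 * z.re) ≠ ⊤ :=
    ENNReal.mul_ne_top (ENNReal.mul_ne_top ENNReal.ofReal_ne_top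
      (ENNReal.pow_ne_top hF.2.ne)) ENNReal.ofReal_ne_top
  have h3 := ENNReal.toReal_mono hfin h1
  simp only [ENNReal.toReal_mul, ENNReal.toReal_pow, toReal_enorm] at h3
  rw [ENNReal.toReal_ofReal (by positivity), ENNReal.toReal_ofReal (by positivity),
    ENNReal.toReal_ofReal (by positivity)] at h3
  rw [le_div_iff₀ hz]
  have : 0 < Real.pi * z.re := by positivity
  nlinarith

end RightHalfPlane

/-! ### Cauchy's formula on a vertical line -/

theorem enorm_integral_mul_le {X : Type*} [MeasurableSpace X] {μ : Measure X} {u v : X → ℂ}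
    (hu : AEStronglyMeasurable u μ) (hv : AEStronglyMeasurable v μ) :
    ‖∫ x, u x * v x ∂μ‖ₑ ≤ eLpNorm u 2 μ * eLpNorm v 2 μ := by
  refine (enorm_integral_le_lintegral_enorm _).trans ?_
  rw [← eLpNorm_one_eq_lintegral_enorm]
  have h : eLpNorm (u • v) 1 μ ≤ eLpNorm u 2 μ * eLpNorm v 2 μ :=
    eLpNorm_smul_le_mul_eLpNorm hv hu
  exact h

theorem integral_exp_neg_mul_halfLine {w : ℂ} (hw : 0 < w.re) :
    ∫ s : ℝ, Complex.exp (-w * s) ∂halfLine = w⁻¹ := by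
  have h := integral_exp_mul_complex_Ioi (a := -w) (by simpa using hw) 0
  rw [h]
  simp [neg_div]

/-- Plancherel again: (a + iy)⁻¹ is the Laplace transform of e^{-as} on the imaginary line. -/
theorem lintegral_enorm_sq_inv_add_mul_I {a : ℝ} (ha : 0 < a) :
    ∫⁻ y : ℝ, ‖((a : ℂ) + (y : ℂ) * Complex.I)⁻¹‖ₑ ^ 2 = ENNReal.ofReal (Real.pi / a) := by
  have h := lintegral_enorm_sq_integral_exp (f := fun s : ℝ => Complex.exp (-(a : ℂ) * s))
    (by
      have := integrableOn_exp_mul_complex_Ioi (a := -(a : ℂ)) (by simpa using ha) 0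
      simpa using this)
    (memLp_exp_neg_mul (by simpa using ha))
  have e : ∀ y : ℝ, ∫ s in Set.Ioi (0 : ℝ),
      Complex.exp (-((y : ℂ) * Complex.I) * s) * Complex.exp (-(a : ℂ) * s) =
        ((a : ℂ) + (y : ℂ) * Complex.I)⁻¹ := fun y => by
    rw [← integral_exp_neg_mul_halfLine (by simpa using ha)]
    congr 1 with s
    rw [← Complex.exp_add]
    congr 1
    ring
  simp_rw [e] at h
  rw [h]
  have e2 : ∫⁻ s in Set.Ioi (0 : ℝ), ‖Complex.exp (-(a : ℂ) * s)‖ₑ ^ 2 =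
      ENNReal.ofReal (1 / (2 * a)) := by
    have e3 : ∀ s : ℝ, ‖Complex.exp (-(a : ℂ) * s)‖ₑ ^ 2 =
        ENNReal.ofReal (Real.exp (-(2 * a) * s)) := fun s => by
      rw [← ofReal_norm, norm_exp_neg_mul, ← ENNReal.ofReal_pow (Real.exp_pos _).le,
        ← Real.exp_nat_mul]
      congr 2
      simp
      ring
    simp_rw [e3]
    rw [← ofReal_integral_eq_lintegral_ofReal
      (integrableOn_exp_mul_Ioi (by linarith) 0) (Filter.Eventually.of_forall fun s =>
        (Real.exp_pos _).le), integral_exp_mul_Ioi (by linarith)]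
    congr 1
    field_simp
    simp
  rw [e2, ← ENNReal.ofReal_mul (by positivity)]
  congr 1
  field_simp

/-- The antiderivative is arctan(y/a) - (i/2) log(a² + y²); the logarithm is even and cancels over a
symmetric interval. Negative a is allowed because lines on both sides of the pole are needed. -/
theorem intervalIntegral_inv_add_mul_I {a : ℝ} (ha : a ≠ 0) (R : ℝ) :
    ∫ y in (-R)..R, ((a : ℂ) + (y : ℂ) * Complex.I)⁻¹ = (2 * Real.arctan (R / a) : ℝ) := by
  have hne : ∀ y : ℝ, (a : ℂ) + (y : ℂ) * Complex.I ≠ 0 := fun y h => ha (by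
    simpa using congrArg Complex.re h)
  have hpos : ∀ y : ℝ, 0 < a ^ 2 + y ^ 2 := fun y => by positivity
  have hd : ∀ y ∈ Set.uIcc (-R) R, HasDerivAt
      (fun y : ℝ => ((Real.arctan (y / a) : ℝ) : ℂ) -
        ((Real.log (a ^ 2 + y ^ 2) / 2 : ℝ) : ℂ) * Complex.I)
      (((a : ℂ) + (y : ℂ) * Complex.I)⁻¹) y := fun y _ => by
    have h1 := (((hasDerivAt_id y).div_const a).arctan).ofReal_comp
    have h2 := ((((hasDerivAt_pow 2 y).const_add (a ^ 2)).log (hpos y).ne').div_const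
      2).ofReal_comp.mul_const Complex.I
    refine (h1.sub h2).congr_deriv ?_
    have h3 : ((a : ℂ) ^ 2 + (y : ℂ) ^ 2) ≠ 0 := by exact_mod_cast (hpos y).ne'
    have h4 : (a : ℂ) ≠ 0 := by exact_mod_cast ha
    have h5 : (1 : ℂ) + ((y : ℂ) / a) ^ 2 ≠ 0 := by
      rw [div_pow, one_add_div (pow_ne_zero 2 h4)]
      exact div_ne_zero h3 (pow_ne_zero 2 h4)
    refine eq_inv_of_mul_eq_one_left ?_
    simp only [id]
    push_cast
    have e1 : (1 : ℂ) / (1 + ((y : ℂ) / a) ^ 2) * (1 / a) = a / (a ^ 2 + y ^ 2) := by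
      field_simp
    rw [e1]
    field_simp
    linear_combination (-(y : ℂ) ^ 2) * Complex.I_sq
  rw [intervalIntegral.integral_eq_sub_of_hasDerivAt hd]
  · rw [neg_div, Real.arctan_neg, neg_sq]
    push_cast
    ring
  · refine Continuous.intervalIntegrable ?_ _ _
    exact (by fun_prop : Continuous fun y : ℝ => (a : ℂ) + (y : ℂ) * Complex.I).inv₀ hne

namespace RightHalfPlane

theorem continuous_line {F : RightHalfPlane → ℂ} (hF : F ∈ hardySpace) {x : ℝ} (hx : 0 < x) :
    Continuous fun y : ℝ => ext F ((x : ℂ) + (y : ℂ) * Complex.I) :=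
  hF.1.continuousOn.comp_continuous (by fun_prop) fun y => by simpa using hx

theorem eLpNorm_line_sq_le (F : RightHalfPlane → ℂ) {x : ℝ} (hx : 0 < x) :
    eLpNorm (fun y : ℝ => ext F ((x : ℂ) + (y : ℂ) * Complex.I)) 2 volume ^ 2 ≤
      ENNReal.ofReal (2 * Real.pi) * hardyNorm F ^ 2 := by
  rw [eLpNorm_two_sq]
  exact lintegral_line_le_hardyNorm F hx

theorem memLp_line {F : RightHalfPlane → ℂ} (hF : F ∈ hardySpace) {x : ℝ} (hx : 0 < x) :
    MemLp (fun y : ℝ => ext F ((x : ℂ) + (y : ℂ) * Complex.I)) 2 volume := by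
  refine ⟨(continuous_line hF hx).aestronglyMeasurable, ?_⟩
  have h := (eLpNorm_line_sq_le F hx).trans_lt
    (ENNReal.mul_lt_top ENNReal.ofReal_lt_top (ENNReal.pow_lt_top hF.2))
  by_contra hc
  rw [not_lt, top_le_iff] at hc
  simp [hc] at h

end RightHalfPlane

open Filter Topology

theorem memLp_inv_line {x : ℝ} {z : ℂ} (h : x ≠ z.re) :
    MemLp (fun y : ℝ => ((x : ℂ) + (y : ℂ) * Complex.I - z)⁻¹) 2 volume := by
  have hne : ∀ y : ℝ, (x : ℂ) + (y : ℂ) * Complex.I - z ≠ 0 := fun y h' => h (by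
    have := congrArg Complex.re h'
    simp at this
    linarith)
  have hc : Continuous fun y : ℝ => ((x : ℂ) + (y : ℂ) * Complex.I - z)⁻¹ :=
    (by fun_prop : Continuous fun y : ℝ => (x : ℂ) + (y : ℂ) * Complex.I - z).inv₀ hne
  refine ⟨hc.aestronglyMeasurable, ?_⟩
  have e : eLpNorm (fun y : ℝ => ((x : ℂ) + (y : ℂ) * Complex.I - z)⁻¹) 2 volume ^ 2 =
      ENNReal.ofReal (Real.pi / |x - z.re|) := by
    rw [eLpNorm_two_sq, ← lintegral_enorm_sq_inv_add_mul_I (abs_pos.2 (sub_ne_zero.2 h)),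
      ← lintegral_add_right_eq_self _ z.im]
    congr 1 with y
    congr 1
    rw [enorm_inv (hne _), enorm_inv, ← ofReal_norm, ← ofReal_norm, Complex.norm_eq_sqrt_sq_add_sq,
      Complex.norm_eq_sqrt_sq_add_sq]
    · simp
    · intro h'
      have := congrArg Complex.re h'
      simp [sub_eq_zero] at this
      exact h this
  by_contra hc
  rw [not_lt, top_le_iff] at hc
  simp [hc] at e

theorem eLpNorm_inv_line_sq {x : ℝ} {z : ℂ} (h : z.re < x) :
    eLpNorm (fun y : ℝ => ((x : ℂ) + (y : ℂ) * Complex.I - z)⁻¹) 2 volume ^ 2 =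
      ENNReal.ofReal (Real.pi / (x - z.re)) := by
  rw [eLpNorm_two_sq, ← lintegral_enorm_sq_inv_add_mul_I (sub_pos.2 h),
    ← lintegral_add_right_eq_self _ z.im]
  congr! 5 with y
  apply Complex.ext <;> simp

namespace RightHalfPlane

theorem integrable_cauchy_line {F : RightHalfPlane → ℂ} (hF : F ∈ hardySpace) {x : ℝ} (hx : 0 < x)
    {z : ℂ} (h : x ≠ z.re) :
    Integrable fun y : ℝ => ext F ((x : ℂ) + (y : ℂ) * Complex.I) *
      ((x : ℂ) + (y : ℂ) * Complex.I - z)⁻¹ :=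
  (memLp_line hF hx).integrable_mul (memLp_inv_line h)

/-- The difference quotient (F(w) - F(z))/(w - z) has no singularity at z, so Cauchy's theorem on
rectangles applies to it. Its second term is not absolutely integrable on the line, hence the limit
over intervals centred at Im z, where it contributes L = ±π. -/
theorem tendsto_intervalIntegral_dslope {F : RightHalfPlane → ℂ} (hF : F ∈ hardySpace) {x : ℝ}
    (hx : 0 < x) {z : ℂ} (h : x ≠ z.re) {L : ℝ}
    (hL : Tendsto (fun R : ℝ => 2 * Real.arctan (R / (x - z.re))) atTop (𝓝 L)) :
    Tendsto (fun R : ℝ => ∫ y in (z.im - R)..(z.im + R),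
      dslope (ext F) z ((x : ℂ) + (y : ℂ) * Complex.I)) atTop
      (𝓝 ((∫ y : ℝ, ext F ((x : ℂ) + (y : ℂ) * Complex.I) *
        ((x : ℂ) + (y : ℂ) * Complex.I - z)⁻¹) - ext F z * L)) := by
  have hne : ∀ y : ℝ, (x : ℂ) + (y : ℂ) * Complex.I - z ≠ 0 := fun y h' => h (by
    have := congrArg Complex.re h'
    simp at this
    linarith)
  have hi := integrable_cauchy_line hF hx h
  have h1 := intervalIntegral_tendsto_integral hi
    (tendsto_atBot_add_const_left atTop z.im tendsto_neg_atTop_atBot)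
    (tendsto_atTop_add_const_left atTop z.im tendsto_id)
  have h2 := ((Complex.continuous_ofReal.tendsto L).comp hL).const_mul (ext F z)
  refine (h1.sub h2).congr fun R => ?_
  have hi2 : IntervalIntegrable (fun y : ℝ => ((x : ℂ) + (y : ℂ) * Complex.I - z)⁻¹) volume
      (z.im - R) (z.im + R) :=
    ((by fun_prop : Continuous fun y : ℝ => (x : ℂ) + (y : ℂ) * Complex.I - z).inv₀
      hne).intervalIntegrable _ _
  have e : ∫ y in (z.im - R)..(z.im + R), ((x : ℂ) + (y : ℂ) * Complex.I - z)⁻¹ =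
      ((2 * Real.arctan (R / (x - z.re)) : ℝ) : ℂ) := by
    rw [← intervalIntegral_inv_add_mul_I (sub_ne_zero.2 h),
      show z.im - R = -R + z.im by ring, show z.im + R = R + z.im by ring,
      ← intervalIntegral.integral_comp_add_right]
    congr 1 with y
    congr 1
    apply Complex.ext <;> simp
  simp only [Function.comp_apply, id, ← sub_eq_add_neg]
  rw [← e, ← intervalIntegral.integral_const_mul, ← intervalIntegral.integral_sub
    hi.intervalIntegrable (hi2.const_mul _)]
  refine intervalIntegral.integral_congr fun y _ => ?_
  rw [dslope_of_ne _ (sub_ne_zero.1 (hne y)), slope_def_field]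
  ring

theorem norm_ext_le {F : RightHalfPlane → ℂ} (hF : F ∈ hardySpace) {z : ℂ} (hz : 0 < z.re) :
    ‖ext F z‖ ≤ 2 * (hardyNorm F).toReal / √z.re := by
  rw [le_div_iff₀ (Real.sqrt_pos.2 hz)]
  refine le_of_sq_le_sq ?_ (by positivity)
  have := norm_ext_sq_le hF hz
  rw [le_div_iff₀ hz] at this
  rw [mul_pow, mul_pow, Real.sq_sqrt hz.le]
  linarith

theorem tendsto_intervalIntegral_dslope_horizontal {F : RightHalfPlane → ℂ} (hF : F ∈ hardySpace)
    {x₀ x₁ : ℝ} (hx : 0 < x₀) (hx₁ : x₀ ≤ x₁) {z : ℂ} {ε : ℝ} (hε : |ε| = 1) :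
    Tendsto (fun R : ℝ => ∫ x in x₀..x₁,
      dslope (ext F) z ((x : ℂ) + ((z.im + ε * R : ℝ) : ℂ) * Complex.I)) atTop (𝓝 0) := by
  set C := 2 * (hardyNorm F).toReal / √x₀ + ‖ext F z‖ with hC
  have hlim : Tendsto (fun R : ℝ => C / R * |x₁ - x₀|) atTop (𝓝 0) := by
    simpa using (tendsto_const_nhds.div_atTop tendsto_id).mul_const |x₁ - x₀|
  refine squeeze_zero_norm' ?_ hlim
  filter_upwards [eventually_gt_atTop 0] with R hR
  refine intervalIntegral.norm_integral_le_of_norm_le_const fun x hx' => ?_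
  rw [Set.uIoc_of_le hx₁] at hx'
  set w : ℂ := (x : ℂ) + ((z.im + ε * R : ℝ) : ℂ) * Complex.I with hw
  have hwre : w.re = x := by simp [hw]
  have hn : R ≤ ‖w - z‖ := by
    have h1 := Complex.abs_im_le_norm (w - z)
    have h2 : (w - z).im = ε * R := by simp [hw]
    rwa [h2, abs_mul, hε, one_mul, abs_of_pos hR] at h1
  have hne : w ≠ z := fun h => by
    rw [h, sub_self, norm_zero] at hn
    linarith
  rw [dslope_of_ne _ hne, slope_def_field, norm_div]
  have h3 : ‖ext F w‖ ≤ 2 * (hardyNorm F).toReal / √x₀ := by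
    refine (norm_ext_le hF (by rw [hwre]; linarith [hx'.1])).trans ?_
    rw [hwre]
    gcongr
    exact hx'.1.le
  gcongr
  exact (norm_sub_le _ _).trans (by rw [hC]; gcongr)

/-- The difference quotient integrates to zero around rectangles of height 2R. The horizontal sides
vanish as R → ∞, and the constants π and -π from the two vertical sides add up to 2π F(z). -/
theorem integral_cauchy_line_sub {F : RightHalfPlane → ℂ} (hF : F ∈ hardySpace) {x₀ x₁ : ℝ}
    (hx : 0 < x₀) {z : ℂ} (h₀ : x₀ < z.re) (h₁ : z.re < x₁) :
    (∫ y : ℝ, ext F ((x₁ : ℂ) + (y : ℂ) * Complex.I) *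
        ((x₁ : ℂ) + (y : ℂ) * Complex.I - z)⁻¹) -
      (∫ y : ℝ, ext F ((x₀ : ℂ) + (y : ℂ) * Complex.I) *
        ((x₀ : ℂ) + (y : ℂ) * Complex.I - z)⁻¹) = 2 * Real.pi * ext F z := by
  have l₁ : Tendsto (fun R : ℝ => 2 * Real.arctan (R / (x₁ - z.re))) atTop (𝓝 Real.pi) := by
    have := ((Real.tendsto_arctan_atTop.mono_right nhdsWithin_le_nhds).comp
      (tendsto_id.atTop_div_const (sub_pos.2 h₁))).const_mul 2
    rwa [mul_div_cancel₀ _ two_ne_zero] at this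
  have l₀ : Tendsto (fun R : ℝ => 2 * Real.arctan (R / (x₀ - z.re))) atTop (𝓝 (-Real.pi)) := by
    have := ((Real.tendsto_arctan_atTop.mono_right nhdsWithin_le_nhds).comp
      (tendsto_id.atTop_div_const (sub_pos.2 h₀))).const_mul (-2)
    rw [show -2 * (Real.pi / 2) = -Real.pi by ring] at this
    refine this.congr fun R => ?_
    rw [← neg_sub z.re x₀, div_neg, Real.arctan_neg]
    simp
  have t₁ := tendsto_intervalIntegral_dslope hF (by linarith) h₁.ne' l₁
  have t₀ := tendsto_intervalIntegral_dslope hF hx h₀.ne l₀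
  have tT := tendsto_intervalIntegral_dslope_horizontal hF hx (h₀.trans h₁).le (z := z)
    (ε := 1) (by simp)
  have tB := tendsto_intervalIntegral_dslope_horizontal hF hx (h₀.trans h₁).le (z := z)
    (ε := -1) (by simp)
  have hd : DifferentiableOn ℂ (dslope (ext F) z) {w : ℂ | 0 < w.re} :=
    (Complex.differentiableOn_dslope (isOpen_re_pos.mem_nhds (hx.trans h₀))).2 hF.1
  have key : ∀ R : ℝ,
      ((∫ x in x₀..x₁, dslope (ext F) z ((x : ℂ) + ((z.im + -1 * R : ℝ) : ℂ) * Complex.I)) -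
      (∫ x in x₀..x₁, dslope (ext F) z ((x : ℂ) + ((z.im + 1 * R : ℝ) : ℂ) * Complex.I)) +
      Complex.I • (∫ y in (z.im - R)..(z.im + R),
        dslope (ext F) z ((x₁ : ℂ) + (y : ℂ) * Complex.I)) -
      Complex.I • (∫ y in (z.im - R)..(z.im + R),
        dslope (ext F) z ((x₀ : ℂ) + (y : ℂ) * Complex.I))) = 0 := fun R => by
    have := Complex.integral_boundary_rect_eq_zero_of_differentiableOn (dslope (ext F) z)
      ⟨x₀, z.im - R⟩ ⟨x₁, z.im + R⟩ (hd.mono fun w hw => ?_)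
    · simpa [sub_eq_add_neg] using this
    · have h2 := hw.1
      simp only [Set.mem_preimage, Set.uIcc_of_le (h₀.trans h₁).le] at h2
      exact hx.trans_le h2.1
  have t := ((tB.sub tT).add (t₁.const_smul Complex.I)).sub (t₀.const_smul Complex.I)
  have := tendsto_nhds_unique (t.congr key) tendsto_const_nhds
  simp only [smul_eq_mul, sub_self, zero_add, ← mul_sub] at this
  have h3 := (mul_eq_zero.1 this).resolve_left Complex.I_ne_zero
  push_cast at h3
  linear_combination h3

/-- The right-hand line is pushed to infinity: by Cauchy–Schwarz its squared contribution is O(1/(x₁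
- Re z)). -/
theorem cauchy_line {F : RightHalfPlane → ℂ} (hF : F ∈ hardySpace) {x₀ : ℝ}
    (hx : 0 < x₀) {z : ℂ} (h₀ : x₀ < z.re) :
    ∫ y : ℝ, ext F ((x₀ : ℂ) + (y : ℂ) * Complex.I) *
        (z - ((x₀ : ℂ) + (y : ℂ) * Complex.I))⁻¹ = 2 * Real.pi * ext F z := by
  set A := ∫ y : ℝ, ext F ((x₀ : ℂ) + (y : ℂ) * Complex.I) *
        ((x₀ : ℂ) + (y : ℂ) * Complex.I - z)⁻¹ with hA
  have bound : ∀ x₁ : ℝ, z.re < x₁ → ‖2 * Real.pi * ext F z + A‖ₑ ^ 2 ≤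
      ENNReal.ofReal (2 * Real.pi) * hardyNorm F ^ 2 * ENNReal.ofReal (Real.pi / (x₁ - z.re)) := by
    intro x₁ h₁
    rw [← integral_cauchy_line_sub hF hx h₀ h₁, sub_add_cancel]
    refine (pow_le_pow_left₀ zero_le (enorm_integral_mul_le
      (memLp_line hF (hx.trans (h₀.trans h₁))).1 (memLp_inv_line h₁.ne').1) 2).trans ?_
    rw [mul_pow, eLpNorm_inv_line_sq h₁]
    exact mul_le_mul_left (eLpNorm_line_sq_le F (hx.trans (h₀.trans h₁))) _
  have lim : Tendsto (fun x₁ : ℝ => ENNReal.ofReal (2 * Real.pi) * hardyNorm F ^ 2 *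
      ENNReal.ofReal (Real.pi / (x₁ - z.re))) atTop (𝓝 0) := by
    have h1 : Tendsto (fun x₁ : ℝ => ENNReal.ofReal (Real.pi / (x₁ - z.re))) atTop (𝓝 0) := by
      rw [← ENNReal.ofReal_zero]
      exact (ENNReal.continuous_ofReal.tendsto 0).comp (tendsto_const_nhds.div_atTop
        (tendsto_atTop_add_const_right _ _ tendsto_id))
    have := ENNReal.Tendsto.const_mul (a := ENNReal.ofReal (2 * Real.pi) * hardyNorm F ^ 2) h1
      (Or.inr (ENNReal.mul_ne_top ENNReal.ofReal_ne_top (ENNReal.pow_ne_top hF.2.ne)))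
    rwa [mul_zero] at this
  have h0 : ‖2 * Real.pi * ext F z + A‖ₑ ^ 2 ≤ 0 :=
    ge_of_tendsto lim ((eventually_gt_atTop z.re).mono bound)
  have h1 : 2 * Real.pi * ext F z + A = 0 := by
    simpa using h0
  rw [eq_neg_of_add_eq_zero_left h1, hA, ← integral_neg]
  congr 1 with y
  rw [← neg_sub ((x₀ : ℂ) + (y : ℂ) * Complex.I) z, inv_neg]
  ring


/-! ### Paley–Wiener by duality -/

/-- The exponential sum `∑ c_z e^{-zs}`. -/
noncomputable def expSum (c : RightHalfPlane →₀ ℂ) (s : ℝ) : ℂ :=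
  ∑ z ∈ c.support, c z * Complex.exp (-(z : ℂ) * s)

theorem memLp_expSum (c : RightHalfPlane →₀ ℂ) : MemLp (expSum c) 2 halfLine :=
  memLp_finsetSum _ fun z _ => (memLp_exp_neg_mul z.2).const_mul _

/-- Each (z - iy)⁻¹ is the transform of e^{-zs} at -iy, and y ↦ -y preserves the integral. -/
theorem lintegral_enorm_sq_sum_inv (c : RightHalfPlane →₀ ℂ) :
    ∫⁻ y : ℝ, ‖∑ z ∈ c.support, c z * ((z : ℂ) - (y : ℂ) * Complex.I)⁻¹‖ₑ ^ 2 =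
      ENNReal.ofReal (2 * Real.pi) * eLpNorm (expSum c) 2 halfLine ^ 2 := by
  have hint : ∀ z : RightHalfPlane, Integrable (fun s : ℝ => Complex.exp (-(z : ℂ) * s)) halfLine :=
    fun z => integrableOn_exp_mul_complex_Ioi (by simpa using z.2) 0
  have hi : IntegrableOn (expSum c) (Set.Ioi 0) :=
    integrable_finsetSum _ fun z _ => (hint z).const_mul _
  rw [eLpNorm_two_sq, ← lintegral_enorm_sq_integral_exp hi (memLp_expSum c)]
  have h := lintegral_comp_mul_left_real (a := -1) (by norm_num)
    (fun y : ℝ => ‖∑ z ∈ c.support, c z * ((z : ℂ) - (y : ℂ) * Complex.I)⁻¹‖ₑ ^ 2)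
  rw [show |(-1 : ℝ)⁻¹| = 1 by norm_num, ENNReal.ofReal_one, one_mul] at h
  rw [← h]
  refine lintegral_congr fun y => ?_
  congr 2
  simp only [expSum, Finset.mul_sum]
  have hw : ∀ z : RightHalfPlane, 0 < ((z : ℂ) + (y : ℂ) * Complex.I).re := fun z => by
    simpa using z.2
  rw [integral_finsetSum]
  · refine Finset.sum_congr rfl fun z _ => ?_
    have e : (z : ℂ) - ((-1 * y : ℝ) : ℂ) * Complex.I = z + y * Complex.I := by
      push_cast
      ring
    rw [e, ← integral_exp_neg_mul_halfLine (hw z), ← integral_const_mul]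
    congr 1 with s
    rw [mul_left_comm, ← Complex.exp_add]
    congr 2
    ring
  · intro z _
    have := (integrableOn_exp_mul_complex_Ioi (a := -((z : ℂ) + (y : ℂ) * Complex.I))
      (by simpa using z.2) 0).const_mul (c z)
    refine this.congr (Eventually.of_forall fun s => ?_)
    simp only
    rw [mul_left_comm, ← Complex.exp_add]
    congr 2
    ring

/-- The values of `F` at finitely many points are controlled by the norms of the corresponding
exponential sums. -/
theorem enorm_sum_le {F : RightHalfPlane → ℂ} (hF : F ∈ hardySpace) (c : RightHalfPlane →₀ ℂ) :
    ‖∑ z ∈ c.support, c z * F z‖ₑ ≤ hardyNorm F * eLpNorm (expSum c) 2 halfLine := by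
  have step : ∀ x : ℝ, 0 < x → ‖∑ z ∈ c.support, c z * ext F (z + x)‖ₑ ≤
      hardyNorm F * eLpNorm (expSum c) 2 halfLine := by
    intro x hx
    set k : ℝ → ℂ := fun y => ∑ z ∈ c.support, c z * ((z : ℂ) - (y : ℂ) * Complex.I)⁻¹ with hk
    have hcont : Continuous k := by
      refine continuous_finsetSum _ fun z _ => continuous_const.mul ?_
      refine (by fun_prop : Continuous fun y : ℝ => (z : ℂ) - (y : ℂ) * Complex.I).inv₀
        fun y h => z.2.ne' ?_
      simpa using congrArg Complex.re h
    -- Shifting both the points and the line by x keeps the Cauchy kernels (z - iy)⁻¹ independent of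
    -- x, so the bound below is uniform and x can tend to 0.
    have e : 2 * Real.pi * ∑ z ∈ c.support, c z * ext F (z + x) =
        ∫ y : ℝ, ext F ((x : ℂ) + (y : ℂ) * Complex.I) * k y := by
      have hz : ∀ z : RightHalfPlane, x < ((z : ℂ) + x).re := fun z => by simpa using z.2
      have hsub : ∀ (z : RightHalfPlane) (y : ℝ),
          (z : ℂ) + x - ((x : ℂ) + (y : ℂ) * Complex.I) = z - y * Complex.I := fun z y => by ring
      simp only [hk, Finset.mul_sum]
      rw [integral_finsetSum]
      · refine Finset.sum_congr rfl fun z _ => ?_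
        rw [mul_left_comm, ← cauchy_line hF hx (hz z), ← integral_const_mul]
        congr 1 with y
        rw [mul_left_comm, hsub]
      · intro z _
        refine ((integrable_cauchy_line hF hx (hz z).ne).const_mul (-c z)).congr
          (Eventually.of_forall fun y => ?_)
        simp only
        rw [← neg_sub ((z : ℂ) + x), inv_neg, hsub]
        ring
    have h1 := enorm_integral_mul_le (memLp_line hF hx).1 hcont.aestronglyMeasurable
      (μ := volume)
    rw [← e, enorm_mul] at h1
    have h2 := pow_le_pow_left₀ zero_le h1 2
    rw [mul_pow, mul_pow, eLpNorm_two_sq _ k, hk, lintegral_enorm_sq_sum_inv] at h2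
    have h3 : ‖(2 * Real.pi : ℂ)‖ₑ = ENNReal.ofReal (2 * Real.pi) := by
      rw [← ofReal_norm]
      congr 1
      simp [Real.pi_pos.le]
    rw [h3] at h2
    have h4 := h2.trans (mul_le_mul_left (eLpNorm_line_sq_le F hx) _)
    have h5 : ENNReal.ofReal (2 * Real.pi) ^ 2 * ‖∑ z ∈ c.support, c z * ext F (z + x)‖ₑ ^ 2 ≤
        ENNReal.ofReal (2 * Real.pi) ^ 2 * (hardyNorm F * eLpNorm (expSum c) 2 halfLine) ^ 2 := by
      refine h4.trans (le_of_eq ?_)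
      ring
    have h6 := (ENNReal.mul_le_mul_iff_right
      (by simpa using Real.pi_pos) (ENNReal.pow_ne_top ENNReal.ofReal_ne_top)).1 h5
    exact (ENNReal.pow_le_pow_left_iff two_ne_zero).1 h6
  have lim : Tendsto (fun x : ℝ => ‖∑ z ∈ c.support, c z * ext F (z + x)‖ₑ) (𝓝[>] 0)
      (𝓝 ‖∑ z ∈ c.support, c z * F z‖ₑ) := by
    refine Tendsto.enorm (tendsto_finsetSum _ fun z _ => Tendsto.const_mul _ ?_)
    rw [← ext_apply F z.2]
    have h1 : ContinuousAt (ext F) ((z : ℂ) + ((0 : ℝ) : ℂ)) := by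
      rw [Complex.ofReal_zero, add_zero]
      exact hF.1.continuousOn.continuousAt (isOpen_re_pos.mem_nhds z.2)
    have h2 : Tendsto (fun x : ℝ => (z : ℂ) + (x : ℂ)) (𝓝[>] 0) (𝓝 ((z : ℂ) + ((0 : ℝ) : ℂ))) :=
      ((by fun_prop : Continuous fun x : ℝ => (z : ℂ) + (x : ℂ)).tendsto 0).mono_left
        nhdsWithin_le_nhds
    have := h1.tendsto.comp h2
    rw [Complex.ofReal_zero, add_zero] at this
    exact this
  exact le_of_tendsto lim (eventually_mem_nhdsWithin.mono step)

/-- The exponential `e^{-zs}` as an element of `L²(0, ∞)`. -/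
noncomputable def expLp (z : RightHalfPlane) : Lp ℂ 2 halfLine := (memLp_exp_neg_mul z.2).toLp _

theorem linearCombination_expLp (c : RightHalfPlane →₀ ℂ) :
    Finsupp.linearCombination ℂ expLp c = (memLp_expSum c).toLp _ := by
  apply Lp.ext
  refine EventuallyEq.trans ?_ (memLp_expSum c).coeFn_toLp.symm
  rw [Finsupp.linearCombination_apply, Finsupp.sum]
  have h : ∀ᵐ s ∂halfLine, ∀ z ∈ c.support, (c z • expLp z : Lp ℂ 2 halfLine) s =
      c z * Complex.exp (-(z : ℂ) * s) := by
    rw [Finset.eventually_all]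
    intro z _
    filter_upwards [Lp.coeFn_smul (c z) (expLp z), (memLp_exp_neg_mul z.2).coeFn_toLp] with s h1 h2
    rw [h1, Pi.smul_apply, expLp, h2, smul_eq_mul]
  have h2 := Lp.coeFn_finsetSum c.support (fun z => c z • expLp z)
  filter_upwards [h, h2] with s h3 h4
  rw [h4, Finset.sum_apply]
  exact Finset.sum_congr rfl h3

/-- **Paley–Wiener**: every function of the Hardy space is a Laplace transform. -/
theorem exists_laplace_eq {F : RightHalfPlane → ℂ} (hF : F ∈ hardySpace) :
    ∃ g : ℝ → ℂ, MemLp g 2 halfLine ∧ F = laplaceHalfPlane g := by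
  set T := Finsupp.linearCombination ℂ expLp with hT
  set ℓ := Finsupp.linearCombination ℂ F with hℓ
  set M := (hardyNorm F).toReal with hM
  have hb : ∀ c, ‖ℓ c‖ ≤ M * ‖T c‖ := fun c => by
    have h := enorm_sum_le hF c
    have h2 := ENNReal.toReal_mono (ENNReal.mul_ne_top hF.2.ne (memLp_expSum c).2.ne) h
    rw [toReal_enorm, ENNReal.toReal_mul] at h2
    rw [hT, linearCombination_expLp, Lp.norm_toLp, hℓ, Finsupp.linearCombination_apply]
    exact h2
  -- The bound `hb` forces ℓ to vanish on the kernel of T, so ℓ factors through the range of T;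
  -- composing with any linear section gives that factorization, and no choice matters.
  obtain ⟨r, hr⟩ := T.rangeRestrict.exists_rightInverse_of_surjective T.range_rangeRestrict
  have hr' : ∀ v : LinearMap.range T, T (r v) = v := fun v =>
    congrArg Subtype.val (LinearMap.congr_fun hr v)
  set φ : LinearMap.range T →L[ℂ] ℂ := (ℓ ∘ₗ r).mkContinuous M fun v => by
    have := hb (r v)
    rw [hr'] at this
    exact this with hφ
  obtain ⟨ψ, hψ, -⟩ := exists_extension_norm_eq (LinearMap.range T) φ
  set h := (InnerProductSpace.toDual ℂ (Lp ℂ 2 halfLine)).symm ψ with hh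
  -- The conjugate appears because the inner product is conjugate-linear in the Riesz vector h.
  refine ⟨fun s => starRingEnd ℂ (h s), (Lp.memLp h).star, funext fun z => ?_⟩
  have e1 : T (Finsupp.single z 1) = expLp z := by simp [hT]
  have e2 : ℓ (Finsupp.single z 1) = F z := by simp [hℓ]
  have hmem : expLp z ∈ LinearMap.range T := ⟨_, e1⟩
  have e3 : ψ (expLp z) = F z := by
    have h1 := hψ ⟨expLp z, hmem⟩
    rw [show ψ (expLp z) = φ ⟨expLp z, hmem⟩ from h1]
    change ℓ (r ⟨expLp z, hmem⟩) = F z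
    have h2 := hb (r ⟨expLp z, hmem⟩ - Finsupp.single z 1)
    rw [map_sub, map_sub, hr', e1, e2, sub_self, norm_zero, mul_zero, norm_le_zero_iff] at h2
    exact sub_eq_zero.1 h2
  have e4 : inner ℂ h (expLp z) = ψ (expLp z) := by
    rw [hh, InnerProductSpace.toDual_symm_apply]
  rw [← e3, ← e4, L2.inner_def]
  refine integral_congr_ae ?_
  filter_upwards [(memLp_exp_neg_mul z.2).coeFn_toLp] with s hs
  rw [expLp, hs, RCLike.inner_apply]


/-! ### The Cesàro operator as an average over (0,1) -/

/-- The density `α (1 - v)^{α - 1}` on `(0, 1)`. -/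
noncomputable def cesaroWeight (α v : ℝ) : ℝ := α * (1 - v) ^ (α - 1)

/-- The law on `(0, 1)` of `v = e^{-t}` when `t` has density `α (1 - e^{-t})^{α-1} e^{-t}`. -/
noncomputable def cesaroMeasure (α : ℝ) : Measure ℝ :=
  (volume.restrict (Set.Ioo 0 1)).withDensity fun v => ENNReal.ofReal (cesaroWeight α v)

theorem measurable_cesaroWeight (α : ℝ) : Measurable (cesaroWeight α) := by
  unfold cesaroWeight
  fun_prop

theorem cesaroWeight_nonneg {α v : ℝ} (hα : 0 < α) (hv : v ∈ Set.Ioo (0 : ℝ) 1) :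
    0 ≤ cesaroWeight α v :=
  mul_nonneg hα.le (Real.rpow_nonneg (by linarith [hv.2]) _)

theorem lintegral_cesaroMeasure (α : ℝ) {f : ℝ → ENNReal} (hf : Measurable f) :
    ∫⁻ v, f v ∂cesaroMeasure α =
      ∫⁻ v in Set.Ioo (0 : ℝ) 1, ENNReal.ofReal (cesaroWeight α v) * f v :=
  lintegral_withDensity_eq_lintegral_mul _ (measurable_cesaroWeight α).ennreal_ofReal hf

theorem integral_cesaroMeasure {α : ℝ} (hα : 0 < α) (f : ℝ → ℂ) :
    ∫ v, f v ∂cesaroMeasure α = ∫ v in Set.Ioo (0 : ℝ) 1, (cesaroWeight α v : ℂ) * f v := by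
  rw [cesaroMeasure, integral_withDensity_eq_integral_toReal_smul
    (measurable_cesaroWeight α).ennreal_ofReal (Eventually.of_forall fun _ => ENNReal.ofReal_lt_top)]
  refine setIntegral_congr_fun measurableSet_Ioo fun v hv => ?_
  rw [ENNReal.toReal_ofReal (cesaroWeight_nonneg hα hv), Complex.real_smul]

theorem integral_one_sub_rpow {β : ℝ} (hβ : 0 < β) :
    IntegrableOn (fun v : ℝ => (1 - v) ^ (β - 1)) (Set.Ioo 0 1) ∧
    ∫ v in Set.Ioo (0 : ℝ) 1, (1 - v) ^ (β - 1) = 1 / β := by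
  have h1 : IntervalIntegrable (fun v : ℝ => v ^ (β - 1)) volume 0 1 :=
    intervalIntegral.intervalIntegrable_rpow' (by linarith)
  have h2 := (h1.comp_sub_left 1).symm
  simp only [sub_zero, sub_self] at h2
  constructor
  · exact ((intervalIntegrable_iff_integrableOn_Ioc_of_le zero_le_one).1 h2).mono_set
      Set.Ioo_subset_Ioc_self
  · rw [← integral_Ioc_eq_integral_Ioo, ← intervalIntegral.integral_of_le zero_le_one,
      intervalIntegral.integral_comp_sub_left (fun v => v ^ (β - 1)), sub_self, sub_zero,
      integral_rpow (Or.inl (by linarith))]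
    simp [Real.zero_rpow hβ.ne']

theorem lintegral_one_sub_rpow {β : ℝ} (hβ : 0 < β) :
    ∫⁻ v in Set.Ioo (0 : ℝ) 1, ENNReal.ofReal ((1 - v) ^ (β - 1)) = ENNReal.ofReal (1 / β) := by
  rw [← (integral_one_sub_rpow hβ).2, ofReal_integral_eq_lintegral_ofReal (integral_one_sub_rpow hβ).1]
  filter_upwards [ae_restrict_mem measurableSet_Ioo] with v hv
  exact Real.rpow_nonneg (by linarith [hv.2]) _

theorem lintegral_cesaroWeight {α : ℝ} (hα : 0 < α) :
    ∫⁻ v in Set.Ioo (0 : ℝ) 1, ENNReal.ofReal (cesaroWeight α v) = 1 := by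
  simp only [cesaroWeight, ENNReal.ofReal_mul hα.le]
  rw [lintegral_const_mul' _ _ ENNReal.ofReal_ne_top, lintegral_one_sub_rpow hα,
    ← ENNReal.ofReal_mul hα.le, mul_one_div_cancel hα.ne', ENNReal.ofReal_one]

theorem ae_cesaroMeasure (α : ℝ) : ∀ᵐ v ∂cesaroMeasure α, v ∈ Set.Ioo (0 : ℝ) 1 :=
  (withDensity_absolutelyContinuous _ _).ae_le (ae_restrict_mem measurableSet_Ioo)

theorem image_exp_neg_Ioi : (fun t : ℝ => Real.exp (-t)) '' Set.Ioi 0 = Set.Ioo 0 1 := by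
  ext v
  constructor
  · rintro ⟨t, ht, rfl⟩
    exact ⟨Real.exp_pos _, Real.exp_lt_one_iff.2 (neg_lt_zero.2 ht)⟩
  · rintro ⟨h0, h1⟩
    exact ⟨-Real.log v, neg_pos.2 (Real.log_neg h0 h1), by simp [Real.exp_log h0]⟩

/-- Substitution v = e^{-t}. The factors e^{∓t/2} of the density and the isometry cancel, while v⁻¹
compensates the Jacobian e^{-t}. -/
theorem cesaroStar_eq_integral {α : ℝ} (hα : 0 < α) (F : RightHalfPlane → ℂ) (z : RightHalfPlane) :
    cesaroStar α F z = ∫ v : ℝ, (v : ℂ)⁻¹ * ext F ((v : ℂ)⁻¹ * z) ∂cesaroMeasure α := by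
  rw [integral_cesaroMeasure hα, ← image_exp_neg_Ioi, integral_image_eq_integral_abs_deriv_smul
    measurableSet_Ioi (f' := fun t => -Real.exp (-t))]
  · refine setIntegral_congr_fun measurableSet_Ioi fun t _ => ?_
    have e1 : ((Real.exp (-t) : ℝ) : ℂ)⁻¹ = (Real.exp t : ℝ) := by
      rw [Real.exp_neg]
      push_cast
      rw [inv_inv]
    have e2 : 0 < (((Real.exp t : ℝ) : ℂ) * z).re := (dilate t z).2
    simp only [cesaroDensity, isometryGroup, cesaroWeight, e1, neg_neg, abs_neg,
      abs_of_pos (Real.exp_pos _), Complex.real_smul]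
    rw [ext_apply F e2]
    have e3 : (⟨((Real.exp t : ℝ) : ℂ) * z, e2⟩ : RightHalfPlane) = dilate t z := rfl
    rw [e3]
    have e4 : (Real.exp (-t / 2) : ℂ) * (Real.exp (t / 2) : ℝ) = 1 := by
      rw [← Complex.ofReal_mul, ← Real.exp_add]
      norm_num [neg_div]
    have e5 : ((Real.exp (-t) : ℝ) : ℂ) * (Real.exp t : ℝ) = 1 := by
      rw [← Complex.ofReal_mul, ← Real.exp_add]
      norm_num
    set A : ℂ := ((Real.exp (-t / 2) : ℝ) : ℂ)
    set B : ℂ := ((Real.exp (t / 2) : ℝ) : ℂ)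
    set C : ℂ := ((Real.exp (-t) : ℝ) : ℂ)
    set D : ℂ := ((Real.exp t : ℝ) : ℂ)
    simp only [Complex.ofReal_mul]
    linear_combination ((α : ℂ) * ((1 - Real.exp (-t)) ^ (α - 1) : ℝ) * F (dilate t z)) * (e4 - e5)
  · intro t _
    have := ((hasDerivAt_neg t).exp).hasDerivWithinAt (s := Set.Ioi 0)
    simpa using this
  · intro a _ b _ h
    simpa using h


/-! ### The vector representing evaluation and its norm -/

instance instSFiniteCesaroMeasure (α : ℝ) : SFinite (cesaroMeasure α) :=
  inferInstanceAs (SFinite ((volume.restrict (Set.Ioo 0 1)).withDensity _))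

/-- The integrand `v⁻¹ e^{-zs/v}` of the Cesàro kernel. -/
noncomputable def cesaroKernelIntegrand (z : ℂ) (v s : ℝ) : ℂ :=
  (v : ℂ)⁻¹ * Complex.exp (-((v : ℂ)⁻¹ * z) * s)

/-- The kernel representing `F = L g ↦ C*_α F (z)` on `L²(0, ∞)`. -/
noncomputable def cesaroKernel (α : ℝ) (z : ℂ) (s : ℝ) : ℂ :=
  ∫ v, cesaroKernelIntegrand z v s ∂cesaroMeasure α

/-- The energy `∬ (v + w)⁻¹` of the Cesàro measure. -/
noncomputable def cesaroEnergy (α : ℝ) : ENNReal :=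
  ∫⁻ p : ℝ × ℝ, ENNReal.ofReal (1 / (p.1 + p.2)) ∂((cesaroMeasure α).prod (cesaroMeasure α))

theorem measurable_cesaroKernelIntegrand (z : ℂ) :
    Measurable fun p : ℝ × ℝ => cesaroKernelIntegrand z p.1 p.2 := by
  unfold cesaroKernelIntegrand
  fun_prop

theorem measurable_cesaroKernelIntegrand_comp {X : Type*} [MeasurableSpace X] (z : ℂ) {f g : X → ℝ}
    (hf : Measurable f) (hg : Measurable g) :
    Measurable fun x => cesaroKernelIntegrand z (f x) (g x) := by
  unfold cesaroKernelIntegrand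
  fun_prop

theorem stronglyMeasurable_cesaroKernel (α : ℝ) (z : ℂ) :
    StronglyMeasurable (cesaroKernel α z) :=
  (measurable_cesaroKernelIntegrand_comp z measurable_snd
    measurable_fst).stronglyMeasurable.integral_prod_right'

theorem norm_cesaroKernelIntegrand (z : ℂ) {v : ℝ} (hv : 0 < v) (s : ℝ) :
    ‖cesaroKernelIntegrand z v s‖ = v⁻¹ * Real.exp (-(v⁻¹ * z.re) * s) := by
  rw [cesaroKernelIntegrand, norm_mul, norm_exp_neg_mul, norm_inv, Complex.norm_real,
    Real.norm_of_nonneg hv.le, ← Complex.ofReal_inv, Complex.re_ofReal_mul, neg_mul]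

theorem lintegral_enorm_mul_cesaroKernelIntegrand {z : ℂ} (hz : 0 < z.re) {v w : ℝ} (hv : 0 < v)
    (hw : 0 < w) :
    ∫⁻ s, ‖cesaroKernelIntegrand z v s‖ₑ * ‖cesaroKernelIntegrand z w s‖ₑ ∂halfLine =
      ENNReal.ofReal z.re⁻¹ * ENNReal.ofReal (1 / (v + w)) := by
  set a : ℝ := (v⁻¹ + w⁻¹) * z.re with ha
  have ha0 : 0 < a := by positivity
  have e : ∀ s : ℝ, ‖cesaroKernelIntegrand z v s‖ₑ * ‖cesaroKernelIntegrand z w s‖ₑ =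
      ENNReal.ofReal (v⁻¹ * w⁻¹) * ENNReal.ofReal (Real.exp (-a * s)) := fun s => by
    rw [← ofReal_norm, ← ofReal_norm, norm_cesaroKernelIntegrand z hv,
      norm_cesaroKernelIntegrand z hw, ← ENNReal.ofReal_mul (by positivity),
      ← ENNReal.ofReal_mul (by positivity), mul_mul_mul_comm, ← Real.exp_add]
    congr 3
    rw [ha]
    ring
  simp_rw [e]
  rw [lintegral_const_mul' _ _ ENNReal.ofReal_ne_top, ← ofReal_integral_eq_lintegral_ofReal
    (integrableOn_exp_mul_Ioi (by linarith) 0) (Eventually.of_forall fun s => (Real.exp_pos _).le),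
    integral_exp_mul_Ioi (by linarith), ← ENNReal.ofReal_mul (by positivity),
    ← ENNReal.ofReal_mul (by positivity)]
  congr 1
  rw [ha]
  field_simp
  simp [add_comm]

theorem integral_mul_conj_cesaroKernelIntegrand {z : ℂ} (hz : 0 < z.re) {v w : ℝ} (hv : 0 < v)
    (hw : 0 < w) :
    ∫ s, cesaroKernelIntegrand z v s * starRingEnd ℂ (cesaroKernelIntegrand z w s) ∂halfLine =
      (w * z + v * starRingEnd ℂ z)⁻¹ := by
  have h : 0 < ((v : ℂ)⁻¹ * z + (w : ℂ)⁻¹ * starRingEnd ℂ z).re := by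
    rw [Complex.add_re, ← Complex.ofReal_inv, ← Complex.ofReal_inv, Complex.re_ofReal_mul,
      Complex.re_ofReal_mul, Complex.conj_re]
    positivity
  have e : ∀ s : ℝ, cesaroKernelIntegrand z v s * starRingEnd ℂ (cesaroKernelIntegrand z w s) =
      ((v : ℂ)⁻¹ * (w : ℂ)⁻¹) *
        Complex.exp (-((v : ℂ)⁻¹ * z + (w : ℂ)⁻¹ * starRingEnd ℂ z) * s) := fun s => by
    simp only [cesaroKernelIntegrand, map_mul, map_inv₀, Complex.conj_ofReal, ← Complex.exp_conj,
      map_neg]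
    rw [mul_mul_mul_comm, ← Complex.exp_add]
    congr 2
    ring
  simp_rw [e]
  rw [integral_const_mul, integral_exp_neg_mul_halfLine h, ← mul_inv, ← mul_inv]
  congr 1
  have h1 : (v : ℂ) ≠ 0 := by exact_mod_cast hv.ne'
  have h2 : (w : ℂ) ≠ 0 := by exact_mod_cast hw.ne'
  field_simp

theorem ae_prod_cesaroMeasure (α : ℝ) :
    ∀ᵐ p : ℝ × ℝ ∂((cesaroMeasure α).prod (cesaroMeasure α)),
      p.1 ∈ Set.Ioo (0 : ℝ) 1 ∧ p.2 ∈ Set.Ioo (0 : ℝ) 1 := by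
  filter_upwards [Measure.quasiMeasurePreserving_fst.ae (ae_cesaroMeasure α),
    Measure.quasiMeasurePreserving_snd.ae (ae_cesaroMeasure α)] with p h1 h2 using ⟨h1, h2⟩

theorem lintegral_prod_enorm_cesaroKernelIntegrand (α : ℝ) {z : ℂ} (hz : 0 < z.re) :
    ∫⁻ s, ∫⁻ p : ℝ × ℝ, ‖cesaroKernelIntegrand z p.1 s‖ₑ * ‖cesaroKernelIntegrand z p.2 s‖ₑ
      ∂((cesaroMeasure α).prod (cesaroMeasure α)) ∂halfLine =
      ENNReal.ofReal z.re⁻¹ * cesaroEnergy α := by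
  rw [lintegral_lintegral_swap]
  · rw [cesaroEnergy, ← lintegral_const_mul' _ _ ENNReal.ofReal_ne_top]
    refine lintegral_congr_ae ?_
    filter_upwards [ae_prod_cesaroMeasure α] with p hp
    exact lintegral_enorm_mul_cesaroKernelIntegrand hz hp.1.1 hp.2.1
  · exact ((measurable_cesaroKernelIntegrand_comp z (measurable_fst.comp measurable_snd)
      measurable_fst).enorm.mul (measurable_cesaroKernelIntegrand_comp z
        (measurable_snd.comp measurable_snd) measurable_fst).enorm).aemeasurable

/-- The square of the inner integral is an integral over the product measure, and integrating in s
first leaves 1/((v+w) Re z). Finiteness of this absolute version puts the kernel in L² and justifies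
the interchanges of integrals. -/
theorem lintegral_sq_lintegral_cesaroKernelIntegrand (α : ℝ) {z : ℂ} (hz : 0 < z.re) :
    ∫⁻ s, (∫⁻ v, ‖cesaroKernelIntegrand z v s‖ₑ ∂cesaroMeasure α) ^ 2 ∂halfLine =
      ENNReal.ofReal z.re⁻¹ * cesaroEnergy α := by
  rw [← lintegral_prod_enorm_cesaroKernelIntegrand α hz]
  refine lintegral_congr fun s => ?_
  have hm : AEMeasurable (fun v => ‖cesaroKernelIntegrand z v s‖ₑ) (cesaroMeasure α) :=
    (measurable_cesaroKernelIntegrand_comp z measurable_id measurable_const).enorm.aemeasurable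
  rw [lintegral_prod_mul hm hm, sq]

theorem memLp_cesaroKernel {α : ℝ} (hE : cesaroEnergy α < ⊤) {z : ℂ} (hz : 0 < z.re) :
    MemLp (cesaroKernel α z) 2 halfLine := by
  refine ⟨(stronglyMeasurable_cesaroKernel α z).aestronglyMeasurable, ?_⟩
  have h : eLpNorm (cesaroKernel α z) 2 halfLine ^ 2 ≤ ENNReal.ofReal z.re⁻¹ * cesaroEnergy α := by
    rw [eLpNorm_two_sq, ← lintegral_sq_lintegral_cesaroKernelIntegrand α hz]
    exact lintegral_mono fun s => pow_le_pow_left₀ zero_le (enorm_integral_le_lintegral_enorm _) 2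
  by_contra hc
  rw [not_lt, top_le_iff] at hc
  rw [hc] at h
  have := h.trans_lt (ENNReal.mul_lt_top ENNReal.ofReal_lt_top hE)
  simp at this

theorem integrable_cesaroKernelIntegrand_mul {α : ℝ} (hE : cesaroEnergy α < ⊤) {z : ℂ}
    (hz : 0 < z.re) {g : ℝ → ℂ} (hg : MemLp g 2 halfLine) :
    Integrable (fun p : ℝ × ℝ => cesaroKernelIntegrand z p.1 p.2 * g p.2)
      ((cesaroMeasure α).prod halfLine) := by
  have hm1 := (measurable_cesaroKernelIntegrand z).aestronglyMeasurable
    (μ := (cesaroMeasure α).prod halfLine)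
  have hm2 : AEStronglyMeasurable (fun p : ℝ × ℝ => g p.2) ((cesaroMeasure α).prod halfLine) :=
    hg.1.comp_snd
  have hm : AEStronglyMeasurable (fun p : ℝ × ℝ => cesaroKernelIntegrand z p.1 p.2 * g p.2)
    ((cesaroMeasure α).prod halfLine) := hm1.mul hm2
  refine ⟨hm, ?_⟩
  rw [HasFiniteIntegral, lintegral_prod_symm _ hm.enorm]
  set u : ℝ → ENNReal := fun s => ∫⁻ v, ‖cesaroKernelIntegrand z v s‖ₑ ∂cesaroMeasure α with hu
  have hum : Measurable u := (measurable_cesaroKernelIntegrand_comp z measurable_snd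
    measurable_fst).enorm.lintegral_prod_right'
  have e : ∀ s, ∫⁻ v, ‖cesaroKernelIntegrand z v s * g s‖ₑ ∂cesaroMeasure α = u s * ‖g s‖ₑ :=
    fun s => by
      simp_rw [enorm_mul]
      exact lintegral_mul_const _
        (measurable_cesaroKernelIntegrand_comp z measurable_id measurable_const).enorm
  simp only [e]
  refine (ENNReal.lintegral_mul_le_Lp_mul_Lq halfLine (p := 2) (q := 2)
    Real.HolderConjugate.two_two hum.aemeasurable hg.1.enorm).trans_lt ?_
  refine ENNReal.mul_lt_top (ENNReal.rpow_lt_top_of_nonneg (by norm_num) ?_)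
    (ENNReal.rpow_lt_top_of_nonneg (by norm_num) ?_)
  · simp only [ENNReal.rpow_ofNat]
    rw [lintegral_sq_lintegral_cesaroKernelIntegrand α hz]
    exact (ENNReal.mul_lt_top ENNReal.ofReal_lt_top hE).ne
  · simp only [ENNReal.rpow_ofNat]
    rw [← eLpNorm_two_sq]
    exact ENNReal.pow_ne_top hg.2.ne

theorem cesaroStar_laplace_eq {α : ℝ} (hα : 0 < α) {g : ℝ → ℂ} (z : RightHalfPlane) :
    cesaroStar α (laplaceHalfPlane g) z =
      ∫ v, ∫ s, cesaroKernelIntegrand z v s * g s ∂halfLine ∂cesaroMeasure α := by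
  rw [cesaroStar_eq_integral hα]
  refine integral_congr_ae ?_
  filter_upwards [ae_cesaroMeasure α] with v hv
  have h : 0 < ((v : ℂ)⁻¹ * z).re := by
    rw [← Complex.ofReal_inv, Complex.re_ofReal_mul]
    exact mul_pos (inv_pos.2 hv.1) z.2
  rw [ext_apply _ h, laplaceHalfPlane, laplace, ← integral_const_mul]
  congr 1 with s
  rw [cesaroKernelIntegrand]
  ring

theorem cesaroStar_laplace {α : ℝ} (hα : 0 < α) (hE : cesaroEnergy α < ⊤) {g : ℝ → ℂ}
    (hg : MemLp g 2 halfLine) (z : RightHalfPlane) :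
    cesaroStar α (laplaceHalfPlane g) z = ∫ s, cesaroKernel α z s * g s ∂halfLine := by
  rw [cesaroStar_laplace_eq hα, integral_integral_swap
    (integrable_cesaroKernelIntegrand_mul hE z.2 hg)]
  congr 1 with s
  exact integral_mul_const _ _

/-- The Poisson-type kernel `Re (wz + v z̄)⁻¹`. -/
noncomputable def poissonWeight (z : ℂ) (v w : ℝ) : ℝ :=
  (v + w) * z.re / ((v + w) ^ 2 * z.re ^ 2 + (w - v) ^ 2 * z.im ^ 2)

theorem re_inv_eq_poissonWeight (z : ℂ) (v w : ℝ) :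
    ((w * z + v * starRingEnd ℂ z)⁻¹).re = poissonWeight z v w := by
  rw [Complex.inv_re, Complex.normSq_apply, poissonWeight]
  simp
  ring

theorem poissonWeight_nonneg {z : ℂ} (hz : 0 < z.re) {v w : ℝ} (hv : 0 < v) (hw : 0 < w) :
    0 ≤ poissonWeight z v w := by
  unfold poissonWeight
  positivity

/-- Writing |k_z|² = k_z · conj k_z as a double integral and integrating in s first gives ∬ (wz + v
z̄)⁻¹. The result is real, so only the real part of the integrand survives. -/
theorem eLpNorm_cesaroKernel_sq {α : ℝ} (hE : cesaroEnergy α < ⊤) {z : ℂ}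
    (hz : 0 < z.re) :
    eLpNorm (cesaroKernel α z) 2 halfLine ^ 2 =
      ∫⁻ p : ℝ × ℝ, ENNReal.ofReal (poissonWeight z p.1 p.2)
        ∂((cesaroMeasure α).prod (cesaroMeasure α)) := by
  set μ := (cesaroMeasure α).prod (cesaroMeasure α) with hμ
  set f : ℝ → ℝ × ℝ → ℂ := fun s p => cesaroKernelIntegrand z p.1 s *
    starRingEnd ℂ (cesaroKernelIntegrand z p.2 s) with hf
  have hint : Integrable (Function.uncurry f) (halfLine.prod μ) := by
    have hm : Measurable (Function.uncurry f) :=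
      (measurable_cesaroKernelIntegrand_comp z (measurable_fst.comp measurable_snd)
        measurable_fst).mul (Complex.continuous_conj.measurable.comp
          (measurable_cesaroKernelIntegrand_comp z (measurable_snd.comp measurable_snd)
            measurable_fst))
    refine ⟨hm.aestronglyMeasurable, ?_⟩
    rw [HasFiniteIntegral, lintegral_prod _ hm.enorm.aemeasurable]
    simp only [Function.uncurry, hf, enorm_mul, RCLike.enorm_conj]
    rw [lintegral_prod_enorm_cesaroKernelIntegrand α hz]
    exact ENNReal.mul_lt_top ENNReal.ofReal_lt_top hE
  have e1 : ∀ s, ∫ p, f s p ∂μ = ((‖cesaroKernel α z s‖ ^ 2 : ℝ) : ℂ) := fun s => by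
    rw [hf, hμ]
    rw [integral_prod_mul (fun v => cesaroKernelIntegrand z v s)
      (fun w => starRingEnd ℂ (cesaroKernelIntegrand z w s)), integral_conj]
    change cesaroKernel α z s * starRingEnd ℂ (cesaroKernel α z s) = _
    rw [Complex.mul_conj, Complex.normSq_eq_norm_sq]
  have e2 : (fun p => ∫ s, f s p ∂halfLine) =ᵐ[μ]
      fun p => (p.2 * z + p.1 * starRingEnd ℂ z)⁻¹ := by
    filter_upwards [ae_prod_cesaroMeasure α] with p hp
    exact integral_mul_conj_cesaroKernelIntegrand hz hp.1.1 hp.2.1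
  have hint2 : Integrable (fun p : ℝ × ℝ => (p.2 * z + p.1 * starRingEnd ℂ z)⁻¹) μ :=
    hint.integral_prod_right.congr e2
  have e3 : ∫ s, ‖cesaroKernel α z s‖ ^ 2 ∂halfLine = ∫ p, poissonWeight z p.1 p.2 ∂μ := by
    have h := integral_integral_swap hint
    simp_rw [e1] at h
    rw [integral_congr_ae e2, integral_complex_ofReal] at h
    have h2 := congrArg Complex.re h
    rw [Complex.ofReal_re] at h2
    rw [h2]
    have h3 := integral_re hint2 (𝕜 := ℂ)
    simp only [RCLike.re_to_complex, re_inv_eq_poissonWeight] at h3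
    exact h3.symm
  have hP : Integrable (fun p : ℝ × ℝ => poissonWeight z p.1 p.2) μ := by
    refine hint2.re.congr (Eventually.of_forall fun p => ?_)
    exact re_inv_eq_poissonWeight z p.1 p.2
  rw [← ofReal_integral_eq_lintegral_ofReal hP, ← e3, ofReal_integral_eq_lintegral_ofReal,
    eLpNorm_two_sq]
  · refine lintegral_congr fun s => ?_
    rw [ENNReal.ofReal_pow (norm_nonneg _), ofReal_norm]
  · exact (memLp_two_iff_integrable_sq_norm (stronglyMeasurable_cesaroKernel α
      z).aestronglyMeasurable).1 (memLp_cesaroKernel hE hz)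
  · exact Eventually.of_forall fun s => sq_nonneg _
  · filter_upwards [ae_prod_cesaroMeasure α] with p hp
    exact poissonWeight_nonneg hz hp.1.1 hp.2.1

end RightHalfPlane

/-! ### Elementary inequalities and the upper bound for α ≤ 1 -/

/-- With s = sin(t/2) and c = cos(t/2), the excess over 1 is 2s(tc - s), and s ≤ t/2 ≤ tc because c
≥ 1/2. -/
theorem one_le_cos_add_mul_sin {θ : ℝ} (h : |θ| ≤ Real.pi / 2) :
    1 ≤ Real.cos θ + θ * Real.sin θ := by
  have main : ∀ t : ℝ, 0 ≤ t → t ≤ Real.pi / 2 → 1 ≤ Real.cos t + t * Real.sin t := by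
    intro t h0 h1
    have hc : 0 ≤ Real.cos t := Real.cos_nonneg_of_neg_pi_div_two_le_of_le (by linarith) h1
    have e1 : Real.cos t = 2 * Real.cos (t / 2) ^ 2 - 1 := by
      rw [← Real.cos_two_mul, mul_div_cancel₀ _ two_ne_zero]
    have e2 : Real.sin t = 2 * Real.sin (t / 2) * Real.cos (t / 2) := by
      rw [← Real.sin_two_mul, mul_div_cancel₀ _ two_ne_zero]
    have e3 := Real.sin_sq_add_cos_sq (t / 2)
    have h2 : Real.sin (t / 2) ≤ t / 2 := Real.sin_le (by linarith)
    have h3 : 0 ≤ Real.sin (t / 2) :=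
      Real.sin_nonneg_of_nonneg_of_le_pi (by linarith) (by linarith)
    have h4 : 1 / 2 ≤ Real.cos (t / 2) := by
      have h5 : 0 ≤ Real.cos (t / 2) :=
        Real.cos_nonneg_of_neg_pi_div_two_le_of_le (by linarith) (by linarith)
      nlinarith [Real.cos_le_one (t / 2)]
    have h6 : Real.sin (t / 2) ≤ t * Real.cos (t / 2) := by nlinarith
    rw [e2]
    nlinarith [mul_nonneg h3 (sub_nonneg.2 h6)]
  have := main |θ| (abs_nonneg _) h
  rw [Real.cos_abs] at this
  rcases abs_cases θ with ⟨h1, _⟩ | ⟨h1, _⟩ <;> rw [h1] at this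
  · exact this
  · simpa using this

theorem ENNReal.rearrangement {a b c d : ENNReal} (hab : a ≤ b) (hcd : c ≤ d) :
    a * d + b * c ≤ a * c + b * d := by
  obtain ⟨e, rfl⟩ := exists_add_of_le hab
  calc a * d + (a + e) * c = a * c + a * d + e * c := by ring
    _ ≤ a * c + a * d + e * d := by gcongr
    _ = _ := by ring

/-- Chebyshev's integral inequality for a monotone and an antitone function. -/
theorem lintegral_mul_le_of_antivary {X : Type*} [MeasurableSpace X] {m : Measure X}
    [IsProbabilityMeasure m] {s : Set X} (hs : ∀ᵐ x ∂m, x ∈ s) {f g : X → ENNReal}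
    (hf : Measurable f) (hg : Measurable g)
    (h : ∀ x ∈ s, ∀ y ∈ s, f x * g x + f y * g y ≤ f x * g y + f y * g x) :
    ∫⁻ x, f x * g x ∂m ≤ (∫⁻ x, f x ∂m) * ∫⁻ x, g x ∂m := by
  have h1 : ∫⁻ x, ∫⁻ y, (f x * g x + f y * g y) ∂m ∂m ≤
      ∫⁻ x, ∫⁻ y, (f x * g y + f y * g x) ∂m ∂m := by
    refine lintegral_mono_ae ?_
    filter_upwards [hs] with x hx
    refine lintegral_mono_ae ?_
    filter_upwards [hs] with y hy using h x hx y hy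
  have h2 : ∀ x, ∫⁻ y, (f x * g x + f y * g y) ∂m = f x * g x + ∫⁻ y, f y * g y ∂m := fun x => by
    rw [lintegral_add_left measurable_const, lintegral_const, measure_univ, mul_one]
  have h3 : ∀ x, ∫⁻ y, (f x * g y + f y * g x) ∂m = f x * (∫⁻ y, g y ∂m) + (∫⁻ y, f y ∂m) * g x :=
    fun x => by
      rw [lintegral_add_left (hg.const_mul _), lintegral_const_mul _ hg, lintegral_mul_const _ hf]
  simp_rw [h2, h3] at h1
  rw [lintegral_add_left (f := fun x => f x * g x) (hf.mul hg), lintegral_const, measure_univ,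
    mul_one, lintegral_add_left (f := fun x => f x * ∫⁻ y, g y ∂m) (hf.mul_const _), lintegral_mul_const _ hf, lintegral_const_mul _ hg,
    ← two_mul, ← two_mul] at h1
  exact (ENNReal.mul_le_mul_iff_right two_ne_zero ENNReal.ofNat_ne_top).1 h1

theorem integral_Ioo_inv_add {v : ℝ} (hv : 0 < v) :
    ∫⁻ w in Set.Ioo (0 : ℝ) 1, ENNReal.ofReal (1 / (v + w)) =
      ENNReal.ofReal (Real.log (1 + v) - Real.log v) := by
  have hc : ContinuousOn (fun w : ℝ => 1 / (v + w)) (Set.Icc 0 1) := by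
    refine continuousOn_const.div (by fun_prop) fun w hw => ?_
    have := hw.1
    positivity
  rw [← ofReal_integral_eq_lintegral_ofReal (hc.integrableOn_Icc.mono_set Set.Ioo_subset_Icc_self)]
  · congr 1
    rw [← integral_Ioc_eq_integral_Ioo, ← intervalIntegral.integral_of_le zero_le_one,
      intervalIntegral.integral_comp_add_left (fun w => 1 / w), integral_one_div_of_pos (by linarith)
      (by linarith), Real.log_div (by positivity) (by positivity)]
    simp [add_comm]
  · filter_upwards [ae_restrict_mem measurableSet_Ioo] with w hw
    have := hw.1
    positivity

theorem lintegral_unitSquare_inv_add :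
    ∫⁻ v in Set.Ioo (0 : ℝ) 1, ∫⁻ w in Set.Ioo (0 : ℝ) 1, ENNReal.ofReal (1 / (v + w)) =
      ENNReal.ofReal (2 * Real.log 2) := by
  rw [setLIntegral_congr_fun measurableSet_Ioo fun v hv => integral_Ioo_inv_add hv.1]
  have i1 : IntervalIntegrable (fun v : ℝ => Real.log (1 + v)) volume 0 1 := by
    have := (intervalIntegral.intervalIntegrable_log' (a := 1) (b := 2)).comp_add_left 1
    norm_num at this
    exact this
  have i2 : IntervalIntegrable (fun v : ℝ => Real.log v) volume 0 1 :=
    intervalIntegral.intervalIntegrable_log'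
  have i := i1.sub i2
  rw [← ofReal_integral_eq_lintegral_ofReal
    (((intervalIntegrable_iff_integrableOn_Ioc_of_le zero_le_one).1 i).mono_set
      Set.Ioo_subset_Ioc_self)]
  · congr 1
    rw [← integral_Ioc_eq_integral_Ioo, ← intervalIntegral.integral_of_le zero_le_one,
      intervalIntegral.integral_sub i1 i2, intervalIntegral.integral_comp_add_left
      (fun v => Real.log v), integral_log, integral_log]
    norm_num
    ring
  · filter_upwards [ae_restrict_mem measurableSet_Ioo] with v hv
    exact sub_nonneg.2 (Real.log_le_log hv.1 (by linarith))

namespace RightHalfPlane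

theorem lintegral_prod_cesaroMeasure (α : ℝ) {f : ℝ × ℝ → ENNReal} (hf : Measurable f) :
    ∫⁻ p, f p ∂((cesaroMeasure α).prod (cesaroMeasure α)) =
      ∫⁻ v in Set.Ioo (0 : ℝ) 1, ENNReal.ofReal (cesaroWeight α v) *
        ∫⁻ w in Set.Ioo (0 : ℝ) 1, ENNReal.ofReal (cesaroWeight α w) * f (v, w) := by
  rw [lintegral_prod _ hf.aemeasurable, lintegral_cesaroMeasure α hf.lintegral_prod_right']
  refine lintegral_congr fun v => ?_
  rw [lintegral_cesaroMeasure α (f := fun w => f (v, w)) (hf.comp measurable_prodMk_left)]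

theorem cesaroWeight_mono {α : ℝ} (hα : 0 < α) (h1 : α ≤ 1) {v w : ℝ} (hvw : v ≤ w) (hw : w < 1) :
    cesaroWeight α v ≤ cesaroWeight α w :=
  mul_le_mul_of_nonneg_left (Real.rpow_le_rpow_of_nonpos (by linarith) (by linarith)
    (by linarith)) hα.le

theorem cesaroWeight_anti {α : ℝ} (h1 : 1 ≤ α) {v w : ℝ} (hvw : v ≤ w) (hw : w < 1) :
    cesaroWeight α w ≤ cesaroWeight α v :=
  mul_le_mul_of_nonneg_left (Real.rpow_le_rpow (by linarith) (by linarith)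
    (by linarith)) (by linarith)

/-- For α ≤ 1 the density increases and has total mass 1, so Chebyshev's inequality against a
decreasing function removes it. -/
theorem lintegral_cesaroWeight_mul_le {α : ℝ} (hα : 0 < α) (h1 : α ≤ 1) {f : ℝ → ENNReal}
    (hf : Measurable f) (hanti : AntitoneOn f (Set.Ioo 0 1)) :
    ∫⁻ v in Set.Ioo (0 : ℝ) 1, ENNReal.ofReal (cesaroWeight α v) * f v ≤
      ∫⁻ v in Set.Ioo (0 : ℝ) 1, f v := by
  have : IsProbabilityMeasure (volume.restrict (Set.Ioo (0 : ℝ) 1)) := ⟨by simp⟩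
  refine (lintegral_mul_le_of_antivary (ae_restrict_mem measurableSet_Ioo)
    (measurable_cesaroWeight α).ennreal_ofReal hf fun x hx y hy => ?_).trans ?_
  · rcases le_total x y with hxy | hxy
    · have := ENNReal.rearrangement
        (ENNReal.ofReal_le_ofReal (cesaroWeight_mono hα h1 hxy hy.2)) (hanti hx hy hxy)
      exact this
    · have := ENNReal.rearrangement
        (ENNReal.ofReal_le_ofReal (cesaroWeight_mono hα h1 hxy hx.2)) (hanti hy hx hxy)
      rw [add_comm, add_comm (ENNReal.ofReal (cesaroWeight α x) * f y)]
      exact this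
  · rw [lintegral_cesaroWeight hα, one_mul]

theorem measurable_ofReal_inv_add :
    Measurable fun p : ℝ × ℝ => ENNReal.ofReal (1 / (p.1 + p.2)) := by
  fun_prop

theorem cesaroEnergy_le_of_le_one {α : ℝ} (hα : 0 < α) (h1 : α ≤ 1) :
    cesaroEnergy α ≤ ENNReal.ofReal (2 * Real.log 2) := by
  rw [cesaroEnergy, lintegral_prod_cesaroMeasure α measurable_ofReal_inv_add,
    ← lintegral_unitSquare_inv_add]
  have anti : ∀ a b c : ℝ, 0 < a → 0 < c → a ≤ b →
      ENNReal.ofReal (1 / (b + c)) ≤ ENNReal.ofReal (1 / (a + c)) := fun a b c ha hc hab =>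
    ENNReal.ofReal_le_ofReal (one_div_le_one_div_of_le (by linarith) (by linarith))
  refine (setLIntegral_mono' measurableSet_Ioo fun v hv => mul_le_mul_right
    (lintegral_cesaroWeight_mul_le hα h1 (f := fun w => ENNReal.ofReal (1 / (v + w)))
      (by fun_prop) fun a ha b _ hab => ?_) _).trans ?_
  · have := anti a b v ha.1 hv.1 hab
    rwa [add_comm b, add_comm a] at this
  · refine lintegral_cesaroWeight_mul_le hα h1 measurable_ofReal_inv_add.lintegral_prod_right'
      fun a ha b _ hab => ?_
    exact setLIntegral_mono' measurableSet_Ioo fun w hw => anti a b w ha.1 hw.1 hab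

/-- For α ≥ 1 the density is at most α, so only the unit-square integral of 1/(v+w) is needed. -/
theorem cesaroEnergy_lt_top {α : ℝ} (hα : 0 < α) : cesaroEnergy α < ⊤ := by
  rcases le_total α 1 with h1 | h1
  · exact (cesaroEnergy_le_of_le_one hα h1).trans_lt ENNReal.ofReal_lt_top
  have hw : ∀ v ∈ Set.Ioo (0 : ℝ) 1,
      ENNReal.ofReal (cesaroWeight α v) ≤ ENNReal.ofReal α := fun v hv => by
    have := cesaroWeight_anti h1 hv.1.le hv.2
    refine ENNReal.ofReal_le_ofReal (this.trans (le_of_eq ?_))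
    simp [cesaroWeight]
  rw [cesaroEnergy, lintegral_prod_cesaroMeasure α measurable_ofReal_inv_add]
  have hle : ∫⁻ v in Set.Ioo (0 : ℝ) 1, ENNReal.ofReal (cesaroWeight α v) *
        ∫⁻ w in Set.Ioo (0 : ℝ) 1, ENNReal.ofReal (cesaroWeight α w) *
          ENNReal.ofReal (1 / (v + w)) ≤
      ∫⁻ v in Set.Ioo (0 : ℝ) 1, ENNReal.ofReal α *
        ∫⁻ w in Set.Ioo (0 : ℝ) 1, ENNReal.ofReal α * ENNReal.ofReal (1 / (v + w)) :=
    setLIntegral_mono' measurableSet_Ioo fun v hv => mul_le_mul' (hw v hv)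
      (setLIntegral_mono' measurableSet_Ioo fun w hw' => mul_le_mul' (hw w hw') le_rfl)
  refine hle.trans_lt ?_
  simp only [lintegral_const_mul' _ _ ENNReal.ofReal_ne_top]
  rw [lintegral_unitSquare_inv_add]
  exact ENNReal.mul_lt_top ENNReal.ofReal_lt_top
    (ENNReal.mul_lt_top ENNReal.ofReal_lt_top ENNReal.ofReal_lt_top)

/-- The squared norm of the Cesàro kernel. -/
noncomputable def kernelEnergy (α : ℝ) (z : ℂ) : ENNReal :=
  ∫⁻ p : ℝ × ℝ, ENNReal.ofReal (poissonWeight z p.1 p.2)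
    ∂((cesaroMeasure α).prod (cesaroMeasure α))

theorem poissonWeight_le {z : ℂ} (hz : 0 < z.re) {v w : ℝ} (hv : 0 < v) (hw : 0 < w) :
    poissonWeight z v w ≤ z.re⁻¹ * (1 / (v + w)) := by
  have h : 0 < v + w := by positivity
  rw [poissonWeight, div_le_iff₀ (by positivity)]
  have e : z.re⁻¹ * (1 / (v + w)) * ((v + w) ^ 2 * z.re ^ 2 + (w - v) ^ 2 * z.im ^ 2) =
      (v + w) * z.re + z.re⁻¹ * (1 / (v + w)) * ((w - v) ^ 2 * z.im ^ 2) := by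
    field_simp
  rw [e]
  exact le_add_of_nonneg_right (by positivity)

theorem kernelEnergy_le_of_le_one {α : ℝ} (hα : 0 < α) (h1 : α ≤ 1) {z : ℂ} (hz : 0 < z.re) :
    kernelEnergy α z ≤ ENNReal.ofReal (2 * Real.log 2 / z.re) := by
  have h : kernelEnergy α z ≤ ENNReal.ofReal z.re⁻¹ * cesaroEnergy α := by
    rw [kernelEnergy, cesaroEnergy, ← lintegral_const_mul' _ _ ENNReal.ofReal_ne_top]
    refine lintegral_mono_ae ?_
    filter_upwards [ae_prod_cesaroMeasure α] with p hp
    rw [← ENNReal.ofReal_mul (inv_pos.2 hz).le]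
    exact ENNReal.ofReal_le_ofReal (poissonWeight_le hz hp.1.1 hp.2.1)
  refine h.trans ((mul_le_mul_right (cesaroEnergy_le_of_le_one hα h1) _).trans (le_of_eq ?_))
  rw [← ENNReal.ofReal_mul (inv_pos.2 hz).le]
  congr 1
  ring

end RightHalfPlane

/-! ### Schur test and the upper bound for α > 1/2 -/

theorem lintegral_lintegral_add_swap {X : Type*} [MeasurableSpace X] {m : Measure X} [SFinite m]
    {T : X → X → ENNReal} (hT : Measurable fun p : X × X => T p.1 p.2) :
    ∫⁻ v, ∫⁻ w, (T v w + T w v) ∂m ∂m = 2 * ∫⁻ v, ∫⁻ w, T v w ∂m ∂m := by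
  have h1 : ∀ v, ∫⁻ w, (T v w + T w v) ∂m = ∫⁻ w, T v w ∂m + ∫⁻ w, T w v ∂m := fun v =>
    lintegral_add_left (f := fun w => T v w) (hT.comp measurable_prodMk_left) _
  simp_rw [h1]
  rw [lintegral_add_left (f := fun v => ∫⁻ w, T v w ∂m) hT.lintegral_prod_right',
    lintegral_lintegral_swap (f := fun v w => T w v) (hT.comp measurable_swap).aemeasurable, two_mul]

namespace RightHalfPlane

theorem measurable_poissonWeight (z : ℂ) :
    Measurable fun p : ℝ × ℝ => poissonWeight z p.1 p.2 := by
  unfold poissonWeight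
  fun_prop

theorem poissonWeight_comm (z : ℂ) (v w : ℝ) : poissonWeight z v w = poissonWeight z w v := by
  unfold poissonWeight
  rw [add_comm v w, ← neg_sub v w, neg_sq]

/-- Partial fractions: N² times the quartic denominator factors as (x² + (Nt-y)²)(x² + (Nt+y)²), and
the sum of the two factors is 2N²(1+t²), proportional to the numerator. -/
theorem hasDerivAt_arctan_add {x y N t t' : ℝ} (hx : 0 < x) (hN : 0 < N)
    (hxy : N ^ 2 = x ^ 2 + y ^ 2) {f : ℝ → ℝ} {w : ℝ} (ht : HasDerivAt f t' w) (hft : f w = t) :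
    HasDerivAt (fun w => N⁻¹ * (Real.arctan ((N * f w - y) / x) + Real.arctan ((N * f w + y) / x)))
      (2 * t' * ((1 + t ^ 2) * x / ((1 + t ^ 2) ^ 2 * x ^ 2 + (t ^ 2 - 1) ^ 2 * y ^ 2))) w := by
  have h1 := (((ht.const_mul N).sub_const y).div_const x).arctan
  have h2 := (((ht.const_mul N).add_const y).div_const x).arctan
  refine ((h1.add h2).const_mul N⁻¹).congr_deriv ?_
  rw [hft]
  have hA : 0 < x ^ 2 + (N * t - y) ^ 2 := by positivity
  have hB : 0 < x ^ 2 + (N * t + y) ^ 2 := by positivity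
  have hQ : 0 < (1 + t ^ 2) ^ 2 * x ^ 2 + (t ^ 2 - 1) ^ 2 * y ^ 2 := by positivity
  have eA : 1 / (1 + ((N * t - y) / x) ^ 2) = x ^ 2 / (x ^ 2 + (N * t - y) ^ 2) := by
    field_simp
  have eB : 1 / (1 + ((N * t + y) / x) ^ 2) = x ^ 2 / (x ^ 2 + (N * t + y) ^ 2) := by
    field_simp
  have hsum : (x ^ 2 + (N * t - y) ^ 2) + (x ^ 2 + (N * t + y) ^ 2) = 2 * N ^ 2 * (1 + t ^ 2) := by
    linear_combination -2 * hxy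
  have hprod : (x ^ 2 + (N * t - y) ^ 2) * (x ^ 2 + (N * t + y) ^ 2) =
      N ^ 2 * ((1 + t ^ 2) ^ 2 * x ^ 2 + (t ^ 2 - 1) ^ 2 * y ^ 2) := by
    linear_combination (N ^ 2 * t ^ 4 - (x ^ 2 + y ^ 2)) * hxy
  rw [eA, eB]
  have e1 : N⁻¹ * (x ^ 2 / (x ^ 2 + (N * t - y) ^ 2) * (N * t' / x) +
      x ^ 2 / (x ^ 2 + (N * t + y) ^ 2) * (N * t' / x)) =
      x * t' * (((x ^ 2 + (N * t - y) ^ 2) + (x ^ 2 + (N * t + y) ^ 2)) /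
        ((x ^ 2 + (N * t - y) ^ 2) * (x ^ 2 + (N * t + y) ^ 2))) := by
    field_simp
    ring
  rw [e1, hsum, hprod]
  field_simp

/-- The homogeneous kernel `poissonWeight` has Schur constant `π / |z|` for the weight
`v ↦ v^{-1/2}`. -/
theorem lintegral_poissonWeight_mul_sqrt_le {z : ℂ} (hz : 0 < z.re) {v : ℝ} (hv : 0 < v) :
    ∫⁻ w in Set.Ioi (0 : ℝ), ENNReal.ofReal (poissonWeight z v w * (√v / √w)) ≤
      ENNReal.ofReal (Real.pi / ‖z‖) := by
  have hN : 0 < ‖z‖ := norm_pos_iff.2 fun h => by simp [h] at hz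
  have hxy : ‖z‖ ^ 2 = z.re ^ 2 + z.im ^ 2 := by
    rw [← Complex.normSq_eq_norm_sq, Complex.normSq_apply]
    ring
  have hsv : 0 < √v := Real.sqrt_pos.2 hv
  -- Antiderivative in the variable t = √(w/v). At w = 0 the two arctangents cancel; at infinity
  -- each tends to π/2.
  set G : ℝ → ℝ := fun w => ‖z‖⁻¹ * (Real.arctan ((‖z‖ * (√w / √v) - z.im) / z.re) +
    Real.arctan ((‖z‖ * (√w / √v) + z.im) / z.re)) with hG
  have hderiv : ∀ w ∈ Set.Ioi (0 : ℝ), HasDerivAt G (poissonWeight z v w * (√v / √w)) w := by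
    intro w (hw : 0 < w)
    have hsw : 0 < √w := Real.sqrt_pos.2 hw
    refine (hasDerivAt_arctan_add hz hN hxy ((Real.hasDerivAt_sqrt hw.ne').div_const √v)
      rfl).congr_deriv ?_
    have e1 : v = √v ^ 2 := (Real.sq_sqrt hv.le).symm
    have e2 : w = √w ^ 2 := (Real.sq_sqrt hw.le).symm
    rw [poissonWeight]
    set a := √v
    set b := √w
    rw [e1, e2]
    have hQ : 0 < (1 + (b / a) ^ 2) ^ 2 * z.re ^ 2 + ((b / a) ^ 2 - 1) ^ 2 * z.im ^ 2 := by
      positivity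
    have hR : 0 < (a ^ 2 + b ^ 2) ^ 2 * z.re ^ 2 + (b ^ 2 - a ^ 2) ^ 2 * z.im ^ 2 := by
      positivity
    have eQ : (1 + (b / a) ^ 2) ^ 2 * z.re ^ 2 + ((b / a) ^ 2 - 1) ^ 2 * z.im ^ 2 =
        ((a ^ 2 + b ^ 2) ^ 2 * z.re ^ 2 + (b ^ 2 - a ^ 2) ^ 2 * z.im ^ 2) / a ^ 4 := by
      field_simp
    rw [eQ]
    field_simp
  have hpos : ∀ w ∈ Set.Ioi (0 : ℝ), 0 ≤ poissonWeight z v w * (√v / √w) := fun w hw =>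
    mul_nonneg (poissonWeight_nonneg hz hv hw) (by positivity)
  have hcont : ContinuousWithinAt G (Set.Ici 0) 0 := by
    refine Continuous.continuousWithinAt ?_
    have := Real.continuous_arctan
    fun_prop
  have hlim : Tendsto G atTop (𝓝 (Real.pi / ‖z‖)) := by
    have h1 : Tendsto (fun w : ℝ => ‖z‖ * (√w / √v)) atTop atTop :=
      (Real.tendsto_sqrt_atTop.atTop_div_const hsv).const_mul_atTop hN
    have h2 := (Real.tendsto_arctan_atTop.mono_right nhdsWithin_le_nhds).comp
      ((tendsto_atTop_add_const_right atTop (-z.im) h1).atTop_div_const hz)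
    have h3 := (Real.tendsto_arctan_atTop.mono_right nhdsWithin_le_nhds).comp
      ((tendsto_atTop_add_const_right atTop z.im h1).atTop_div_const hz)
    have h4 := (h2.add h3).const_mul ‖z‖⁻¹
    rw [show ‖z‖⁻¹ * (Real.pi / 2 + Real.pi / 2) = Real.pi / ‖z‖ by ring] at h4
    exact h4
  have h0 : G 0 = 0 := by
    simp [hG, neg_div, Real.arctan_neg]
  rw [← ofReal_integral_eq_lintegral_ofReal
    (integrableOn_Ioi_deriv_of_nonneg hcont hderiv hpos hlim)
    ((ae_restrict_mem measurableSet_Ioi).mono hpos),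
    integral_Ioi_of_hasDerivAt_of_nonneg hcont hderiv hpos hlim, h0, sub_zero]

theorem lintegral_cesaroWeight_sq {α : ℝ} (hα : 1 / 2 < α) :
    ∫⁻ v in Set.Ioo (0 : ℝ) 1, ENNReal.ofReal (cesaroWeight α v) ^ 2 =
      ENNReal.ofReal (α ^ 2 / (2 * α - 1)) := by
  have e : ∀ v ∈ Set.Ioo (0 : ℝ) 1, ENNReal.ofReal (cesaroWeight α v) ^ 2 =
      ENNReal.ofReal (α ^ 2) * ENNReal.ofReal ((1 - v) ^ ((2 * α - 1) - 1)) := fun v hv => by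
    rw [← ENNReal.ofReal_pow (cesaroWeight_nonneg (by linarith) hv),
      ← ENNReal.ofReal_mul (sq_nonneg α), cesaroWeight, mul_pow, ← Real.rpow_mul_natCast
      (by linarith [hv.2])]
    congr 3
    push_cast
    ring
  rw [setLIntegral_congr_fun measurableSet_Ioo e, lintegral_const_mul' _ _ ENNReal.ofReal_ne_top,
    lintegral_one_sub_rpow (by linarith), ← ENNReal.ofReal_mul (sq_nonneg α)]
  congr 1
  ring

theorem kernelEnergy_eq (α : ℝ) (z : ℂ) :
    kernelEnergy α z = ∫⁻ v in Set.Ioo (0 : ℝ) 1, ∫⁻ w in Set.Ioo (0 : ℝ) 1,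
      ENNReal.ofReal (cesaroWeight α v) * ENNReal.ofReal (cesaroWeight α w) *
        ENNReal.ofReal (poissonWeight z v w) := by
  rw [kernelEnergy, lintegral_prod_cesaroMeasure α (measurable_poissonWeight z).ennreal_ofReal]
  refine lintegral_congr fun v => ?_
  rw [← lintegral_const_mul' _ _ ENNReal.ofReal_ne_top]
  simp_rw [mul_assoc]

/-- Weighted AM–GM, from (a√v - b√w)² ≥ 0. The two terms on the right exchange roles under v ↔ w, as
the Schur test requires. -/
theorem two_mul_weight_mul_poissonWeight_le {α : ℝ} (hα0 : 0 < α) {z : ℂ} (hz : 0 < z.re) {v w : ℝ}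
    (hv : v ∈ Set.Ioo (0 : ℝ) 1) (hw : w ∈ Set.Ioo (0 : ℝ) 1) :
    2 * (ENNReal.ofReal (cesaroWeight α v) * ENNReal.ofReal (cesaroWeight α w) *
      ENNReal.ofReal (poissonWeight z v w)) ≤
    ENNReal.ofReal (cesaroWeight α v) ^ 2 * ENNReal.ofReal (poissonWeight z v w * (√v / √w)) +
      ENNReal.ofReal (cesaroWeight α w) ^ 2 * ENNReal.ofReal (poissonWeight z w v * (√w / √v)) := by
  have h1 := cesaroWeight_nonneg hα0 hv
  have h2 := cesaroWeight_nonneg hα0 hw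
  have h3 := poissonWeight_nonneg hz hv.1 hw.1
  have hsv : 0 < √v := Real.sqrt_pos.2 hv.1
  have hsw : 0 < √w := Real.sqrt_pos.2 hw.1
  rw [poissonWeight_comm z w v, ← ENNReal.ofReal_pow h1, ← ENNReal.ofReal_pow h2,
    ← ENNReal.ofReal_mul h1, ← ENNReal.ofReal_mul (mul_nonneg h1 h2),
    ← ENNReal.ofReal_mul (sq_nonneg _), ← ENNReal.ofReal_mul (sq_nonneg _),
    ← ENNReal.ofReal_add (by positivity) (by positivity),
    show (2 : ENNReal) = ENNReal.ofReal 2 by simp, ← ENNReal.ofReal_mul (by norm_num)]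
  refine ENNReal.ofReal_le_ofReal ?_
  set a := cesaroWeight α v
  set b := cesaroWeight α w
  have key : 2 * (a * b) ≤ a ^ 2 * (√v / √w) + b ^ 2 * (√w / √v) := by
    have e : a ^ 2 * (√v / √w) + b ^ 2 * (√w / √v) - 2 * (a * b) =
        (a * √v - b * √w) ^ 2 / (√v * √w) := by
      field_simp
      ring
    have : 0 ≤ (a * √v - b * √w) ^ 2 / (√v * √w) := by positivity
    linarith
  nlinarith [mul_le_mul_of_nonneg_right key h3]

theorem kernelEnergy_le_of_half_lt {α : ℝ} (hα : 1 / 2 < α) {z : ℂ} (hz : 0 < z.re) :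
    kernelEnergy α z ≤ ENNReal.ofReal (Real.pi * α ^ 2 / ((2 * α - 1) * ‖z‖)) := by
  have hα0 : 0 < α := by linarith
  set T : ℝ → ℝ → ENNReal := fun v w => ENNReal.ofReal (cesaroWeight α v) ^ 2 *
    ENNReal.ofReal (poissonWeight z v w * (√v / √w)) with hT
  have hTm : Measurable fun p : ℝ × ℝ => T p.1 p.2 := by
    have := measurable_poissonWeight z
    have h2 := measurable_cesaroWeight α
    simp only [hT]
    fun_prop
  have hTle : ∫⁻ v in Set.Ioo (0 : ℝ) 1, ∫⁻ w in Set.Ioo (0 : ℝ) 1, T v w ≤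
      ENNReal.ofReal (Real.pi * α ^ 2 / ((2 * α - 1) * ‖z‖)) := by
    calc _ ≤ ∫⁻ v in Set.Ioo (0 : ℝ) 1, ENNReal.ofReal (cesaroWeight α v) ^ 2 *
          ENNReal.ofReal (Real.pi / ‖z‖) := by
          refine setLIntegral_mono' measurableSet_Ioo fun v hv => ?_
          rw [lintegral_const_mul' _ _ (ENNReal.pow_ne_top ENNReal.ofReal_ne_top)]
          exact mul_le_mul_right ((lintegral_mono_set Set.Ioo_subset_Ioi_self).trans
            (lintegral_poissonWeight_mul_sqrt_le hz hv.1)) _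
      _ = _ := by
          rw [lintegral_mul_const' _ _ ENNReal.ofReal_ne_top, lintegral_cesaroWeight_sq hα,
            ← ENNReal.ofReal_mul (div_nonneg (sq_nonneg α) (by linarith))]
          congr 1
          rw [div_mul_div_comm, mul_comm (α ^ 2)]
  have hpt : ∀ v ∈ Set.Ioo (0 : ℝ) 1, ∀ w ∈ Set.Ioo (0 : ℝ) 1,
      2 * (ENNReal.ofReal (cesaroWeight α v) * ENNReal.ofReal (cesaroWeight α w) *
        ENNReal.ofReal (poissonWeight z v w)) ≤ T v w + T w v :=
    fun v hv w hw => two_mul_weight_mul_poissonWeight_le hα0 hz hv hw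
  have h2 : 2 * kernelEnergy α z ≤
      2 * ENNReal.ofReal (Real.pi * α ^ 2 / ((2 * α - 1) * ‖z‖)) := by
    rw [kernelEnergy_eq, ← lintegral_const_mul' _ _ ENNReal.ofNat_ne_top]
    simp_rw [← lintegral_const_mul' _ _ (ENNReal.ofNat_ne_top (n := 2))]
    calc _ ≤ ∫⁻ v in Set.Ioo (0 : ℝ) 1, ∫⁻ w in Set.Ioo (0 : ℝ) 1, (T v w + T w v) :=
          setLIntegral_mono' measurableSet_Ioo fun v hv =>
            setLIntegral_mono' measurableSet_Ioo fun w hw => hpt v hv w hw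
      _ = 2 * ∫⁻ v in Set.Ioo (0 : ℝ) 1, ∫⁻ w in Set.Ioo (0 : ℝ) 1, T v w :=
          lintegral_lintegral_add_swap hTm
      _ ≤ _ := mul_le_mul_right hTle _
  exact (ENNReal.mul_le_mul_iff_right two_ne_zero ENNReal.ofNat_ne_top).1 h2


/-! ### Lower bounds from the region below the diagonal -/

/-- The antiderivative of (wz + v z̄)⁻¹ is Log(wz + v z̄)/z, whose argument stays in the right
half-plane. Between w = 0 and w = v the terms log v cancel, as homogeneity predicts. -/
theorem integral_poissonWeight {z : ℂ} (hz : 0 < z.re) {v : ℝ} (hv : 0 < v) :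
    IntegrableOn (fun w => poissonWeight z v w) (Set.Ioo 0 v) ∧
    ∫ w in Set.Ioo 0 v, poissonWeight z v w =
      (z.re * Real.log (2 * z.re / ‖z‖) + z.im * z.arg) / ‖z‖ ^ 2 := by
  have hN : 0 < ‖z‖ := norm_pos_iff.2 fun h => by simp [h] at hz
  have hre : ∀ w ∈ Set.uIcc 0 v, 0 < ((w : ℂ) * z + v * starRingEnd ℂ z).re := fun w hw => by
    rw [Set.uIcc_of_le hv.le] at hw
    have : 0 < (v + w) * z.re := mul_pos (by linarith [hw.1]) hz
    simpa [add_mul, add_comm] using this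
  have hne : ∀ w ∈ Set.uIcc 0 v, (w : ℂ) * z + v * starRingEnd ℂ z ≠ 0 := fun w hw h => by
    have := hre w hw
    simp [h] at this
  have hz0 : z ≠ 0 := norm_pos_iff.1 hN
  have hd : ∀ w ∈ Set.uIcc 0 v, HasDerivAt
      (fun w : ℝ => Complex.log ((w : ℂ) * z + v * starRingEnd ℂ z) * z⁻¹)
      (((w : ℂ) * z + v * starRingEnd ℂ z)⁻¹) w := fun w hw => by
    have h1 : HasDerivAt (fun w : ℝ => (w : ℂ) * z + v * starRingEnd ℂ z) z w := by
      simpa using ((hasDerivAt_id w).ofReal_comp.mul_const z).add_const (v * starRingEnd ℂ z)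
    refine ((h1.clog_real (Or.inl (hre w hw))).mul_const z⁻¹).congr_deriv ?_
    field_simp
  have hi : IntervalIntegrable (fun w : ℝ => ((w : ℂ) * z + v * starRingEnd ℂ z)⁻¹) volume 0 v :=
    ContinuousOn.intervalIntegrable (ContinuousOn.inv₀ (by fun_prop) hne)
  have hI := ((intervalIntegrable_iff_integrableOn_Ioc_of_le hv.le).1 hi)
  have hFTC := intervalIntegral.integral_eq_sub_of_hasDerivAt hd hi
  rw [intervalIntegral.integral_of_le hv.le, integral_Ioc_eq_integral_Ioo] at hFTC
  have hP : ∀ w : ℝ, (((w : ℂ) * z + v * starRingEnd ℂ z)⁻¹).re = poissonWeight z v w :=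
    re_inv_eq_poissonWeight z v
  have hI2 : IntegrableOn (fun w : ℝ => ((w : ℂ) * z + v * starRingEnd ℂ z)⁻¹) (Set.Ioo 0 v) :=
    hI.mono_set Set.Ioo_subset_Ioc_self
  have hre2 := integral_re hI2 (𝕜 := ℂ)
  constructor
  · exact hI2.re.congr (Eventually.of_forall fun w => hP w)
  · simp only [RCLike.re_to_complex, hP] at hre2
    rw [hre2, hFTC, ← sub_mul]
    have e1 : (v : ℂ) * z + v * starRingEnd ℂ z = ((v * (2 * z.re) : ℝ) : ℂ) := by
      rw [← mul_add, Complex.add_conj]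
      push_cast
      ring
    have e2 : Complex.log ((0 : ℝ) * z + v * starRingEnd ℂ z) =
        ((Real.log v + Real.log ‖z‖ : ℝ) : ℂ) - z.arg * Complex.I := by
      have hpi : z.arg ≠ Real.pi := fun h => by
        have := (Complex.arg_eq_pi_iff.1 h).1
        linarith
      rw [Complex.ofReal_zero, zero_mul, zero_add, Complex.log_ofReal_mul hv
        ((map_ne_zero _).2 hz0), Complex.log_conj _ hpi, Complex.log]
      simp [sub_eq_add_neg, add_assoc]
    rw [e1, e2, ← Complex.ofReal_log (by positivity)]
    have e3 : ((Real.log (v * (2 * z.re)) : ℝ) : ℂ) -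
        (((Real.log v + Real.log ‖z‖ : ℝ) : ℂ) - z.arg * Complex.I) =
        ((Real.log (2 * z.re / ‖z‖) : ℝ) : ℂ) + z.arg * Complex.I := by
      rw [Real.log_mul hv.ne' (by positivity), Real.log_div (by positivity) hN.ne']
      push_cast
      ring
    rw [e3, Complex.inv_def, Complex.normSq_eq_norm_sq, ← mul_assoc, Complex.re_mul_ofReal,
      div_eq_mul_inv]
    congr 1
    simp only [Complex.mul_re, Complex.add_re, Complex.ofReal_re, Complex.conj_re, Complex.add_im,
      Complex.ofReal_im, Complex.conj_im, Complex.I_re, Complex.I_im, Complex.mul_im]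
    ring

/-- In the closed form, log u ≥ 1 - 1/u bounds the logarithmic term below by Re z - |z|/2, and cos θ
+ θ sin θ ≥ 1 gives Re z + θ Im z ≥ |z|. Together the numerator is at least |z|/2. -/
theorem le_lintegral_poissonWeight {z : ℂ} (hz : 0 < z.re) {v : ℝ} (hv : 0 < v) :
    ENNReal.ofReal (1 / (2 * ‖z‖)) ≤
      ∫⁻ w in Set.Ioo 0 v, ENNReal.ofReal (poissonWeight z v w) := by
  have hN : 0 < ‖z‖ := norm_pos_iff.2 fun h => by simp [h] at hz
  obtain ⟨hi, he⟩ := integral_poissonWeight hz hv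
  rw [← ofReal_integral_eq_lintegral_ofReal hi, he]
  · refine ENNReal.ofReal_le_ofReal ?_
    have hlog := Real.one_sub_inv_le_log_of_pos (x := 2 * z.re / ‖z‖) (by positivity)
    have h1 : z.re - ‖z‖ / 2 ≤ z.re * Real.log (2 * z.re / ‖z‖) := by
      have := mul_le_mul_of_nonneg_left hlog hz.le
      have e : z.re * (1 - (2 * z.re / ‖z‖)⁻¹) = z.re - ‖z‖ / 2 := by field_simp
      linarith
    have h2 := one_le_cos_add_mul_sin (Complex.abs_arg_le_pi_div_two_iff.2 hz.le)
    have h3 : ‖z‖ ≤ z.re + z.im * z.arg := by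
      have h4 := mul_le_mul_of_nonneg_left h2 hN.le
      rw [mul_one, mul_add, Complex.norm_mul_cos_arg, mul_left_comm, Complex.norm_mul_sin_arg] at h4
      linarith
    rw [div_le_div_iff₀ (by positivity) (by positivity)]
    nlinarith
  · filter_upwards [ae_restrict_mem measurableSet_Ioo] with w hw
    exact poissonWeight_nonneg hz hv hw.1

/-- The free function c serves both ranges of α: the squared density when it decreases, the constant
α² when it increases. The factor 2 from symmetry cancels the one in 1/(2|z|). -/
theorem le_kernelEnergy {α : ℝ} {z : ℂ} (hz : 0 < z.re) {c : ℝ → ENNReal}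
    (hct : ∀ v, c v ≠ ⊤) (hc : ∀ v w, 0 < w → w < v → v < 1 →
      c v ≤ ENNReal.ofReal (cesaroWeight α v) * ENNReal.ofReal (cesaroWeight α w)) :
    (∫⁻ v in Set.Ioo (0 : ℝ) 1, c v) * ENNReal.ofReal (1 / ‖z‖) ≤ kernelEnergy α z := by
  have hm : Measurable fun p : ℝ × ℝ => ENNReal.ofReal (cesaroWeight α p.1) *
      ENNReal.ofReal (cesaroWeight α p.2) * ENNReal.ofReal (poissonWeight z p.1 p.2) := by
    have h1 := measurable_cesaroWeight α
    have h2 := measurable_poissonWeight z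
    fun_prop
  set f : ℝ → ℝ → ENNReal := fun v w => ENNReal.ofReal (cesaroWeight α v) *
    ENNReal.ofReal (cesaroWeight α w) * ENNReal.ofReal (poissonWeight z v w) with hf
  set g : ℝ → ℝ → ENNReal := fun v w => (Set.Iio v).indicator (f v) w with hg
  have hgm : Measurable fun p : ℝ × ℝ => g p.1 p.2 := by
    have : (fun p : ℝ × ℝ => g p.1 p.2) =
        {p : ℝ × ℝ | p.2 < p.1}.indicator fun p => f p.1 p.2 := by
      funext p
      by_cases h : p.2 < p.1 <;> simp [hg, h]
    rw [this]
    exact hm.indicator (measurableSet_lt measurable_snd measurable_fst)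
  have hsymm : ∀ v w, f v w = f w v := fun v w => by
    simp only [hf]
    rw [poissonWeight_comm, mul_comm (ENNReal.ofReal (cesaroWeight α v))]
  have hle : ∀ v w, g v w + g w v ≤ f v w := fun v w => by
    rcases lt_trichotomy v w with h | h | h
    · simp [hg, h, h.not_gt, hsymm w v]
    · simp [hg, h]
    · simp [hg, h, h.not_gt]
  have h1 : 2 * ∫⁻ v in Set.Ioo (0 : ℝ) 1, ∫⁻ w in Set.Ioo (0 : ℝ) 1, g v w ≤ kernelEnergy α z := by
    rw [← lintegral_lintegral_add_swap hgm, kernelEnergy_eq]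
    exact lintegral_mono fun v => lintegral_mono fun w => hle v w
  refine le_trans ?_ h1
  have h2 : ∀ v ∈ Set.Ioo (0 : ℝ) 1, c v * ENNReal.ofReal (1 / (2 * ‖z‖)) ≤
      ∫⁻ w in Set.Ioo (0 : ℝ) 1, g v w := fun v hv => by
    calc c v * ENNReal.ofReal (1 / (2 * ‖z‖))
        ≤ c v * ∫⁻ w in Set.Ioo 0 v, ENNReal.ofReal (poissonWeight z v w) :=
          mul_le_mul_right (le_lintegral_poissonWeight hz hv.1) _
      _ = ∫⁻ w in Set.Ioo 0 v, c v * ENNReal.ofReal (poissonWeight z v w) :=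
          (lintegral_const_mul' _ _ (hct v)).symm
      _ ≤ ∫⁻ w in Set.Ioo 0 v, g v w := by
          refine setLIntegral_mono' measurableSet_Ioo fun w hw => ?_
          simp only [hg, Set.indicator_of_mem (Set.mem_Iio.2 hw.2)]
          exact mul_le_mul_left (hc v w hw.1 hw.2 hv.2) _
      _ ≤ _ := lintegral_mono_set (Set.Ioo_subset_Ioo_right hv.2.le)
  calc (∫⁻ v in Set.Ioo (0 : ℝ) 1, c v) * ENNReal.ofReal (1 / ‖z‖)
      = 2 * ∫⁻ v in Set.Ioo (0 : ℝ) 1, c v * ENNReal.ofReal (1 / (2 * ‖z‖)) := by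
        rw [lintegral_mul_const' _ _ ENNReal.ofReal_ne_top, mul_left_comm,
          show (2 : ENNReal) = ENNReal.ofReal 2 by simp, ← ENNReal.ofReal_mul (by norm_num)]
        congr 2
        rw [one_div, one_div, mul_inv, mul_inv_cancel_left₀ two_ne_zero]
    _ ≤ _ := mul_le_mul_right (setLIntegral_mono' measurableSet_Ioo h2) _

theorem le_kernelEnergy_of_one_le {α : ℝ} (hα : 1 ≤ α) {z : ℂ} (hz : 0 < z.re) :
    ENNReal.ofReal (α ^ 2 / ((2 * α - 1) * ‖z‖)) ≤ kernelEnergy α z := by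
  refine le_trans (le_of_eq ?_) (le_kernelEnergy hz
    (c := fun v => ENNReal.ofReal (cesaroWeight α v) ^ 2)
    (fun v => ENNReal.pow_ne_top ENNReal.ofReal_ne_top) fun v w _ hwv hv => ?_)
  · rw [lintegral_cesaroWeight_sq (by linarith),
      ← ENNReal.ofReal_mul (div_nonneg (sq_nonneg α) (by linarith)), div_mul_div_comm, mul_one]
  · rw [sq]
    exact mul_le_mul_right (ENNReal.ofReal_le_ofReal (cesaroWeight_anti hα hwv.le hv)) _

theorem le_kernelEnergy_of_le_one {α : ℝ} (hα : 0 < α) (h1 : α ≤ 1) {z : ℂ} (hz : 0 < z.re) :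
    ENNReal.ofReal (α ^ 2 / ‖z‖) ≤ kernelEnergy α z := by
  have hw : ∀ v : ℝ, 0 < v → v < 1 → ENNReal.ofReal α ≤ ENNReal.ofReal (cesaroWeight α v) :=
    fun v h0 hv => by
      have := cesaroWeight_mono hα h1 h0.le hv
      refine ENNReal.ofReal_le_ofReal (le_trans (le_of_eq ?_) this)
      simp [cesaroWeight]
  refine le_trans (le_of_eq ?_) (le_kernelEnergy hz (c := fun _ => ENNReal.ofReal α ^ 2)
    (fun v => ENNReal.pow_ne_top ENNReal.ofReal_ne_top) fun v w h0 hwv hv => ?_)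
  · rw [lintegral_const, Measure.restrict_apply_univ, Real.volume_Ioo, sub_zero,
      ENNReal.ofReal_one, mul_one, ← ENNReal.ofReal_pow hα.le, ← ENNReal.ofReal_mul (sq_nonneg α)]
    congr 1
    ring
  · rw [sq]
    exact mul_le_mul' (hw v (h0.trans hwv) hv) (hw w h0 (hwv.trans hv))

end RightHalfPlane

/-! ### Injectivity of the Cesàro operator -/

theorem rpow_le_mul_exp {α b s : ℝ} (hα : 0 < α) (hb : 0 < b) (hs : 0 ≤ s) :
    s ^ α ≤ (α / b) ^ α * Real.exp (b * s) := by
  have h1 : s ≤ α / b * Real.exp (b * s / α) := by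
    have := Real.add_one_le_exp (b * s / α)
    have h2 : α / b * (b * s / α) = s := by field_simp
    have h3 : 0 < α / b := by positivity
    nlinarith
  calc s ^ α ≤ (α / b * Real.exp (b * s / α)) ^ α := Real.rpow_le_rpow hs h1 hα.le
    _ = (α / b) ^ α * Real.exp (b * s) := by
      rw [Real.mul_rpow (by positivity) (Real.exp_pos _).le, ← Real.exp_mul,
        div_mul_cancel₀ _ hα.ne']

theorem image_div_add_Ioi {r : ℝ} (hr : 0 < r) :
    (fun u : ℝ => r / (r + u)) '' Set.Ioi 0 = Set.Ioo 0 1 := by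
  ext v
  constructor
  · rintro ⟨u, hu, rfl⟩
    have hu : 0 < u := hu
    exact ⟨by positivity, (div_lt_one (by positivity)).2 (by linarith)⟩
  · rintro ⟨h0, h1⟩
    refine ⟨r / v - r, ?_, ?_⟩
    · have : r < r / v := by
        rw [lt_div_iff₀ h0]
        nlinarith
      exact sub_pos.2 this
    · simp only [add_sub_cancel]
      field_simp

namespace RightHalfPlane

/-- The averages of dilates of `g` against the Cesàro measure: the operator on `L²(0, ∞)`
corresponding to `C*_α` under the Laplace transform. -/
noncomputable def cesaroAverage (α : ℝ) (g : ℝ → ℂ) (s : ℝ) : ℂ :=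
  ∫ v, g (v * s) ∂cesaroMeasure α

/-- Fubini and the scaling r = vs move the average from g to h. The exponential bound on h dominates
everything by the integrand of the Cesàro kernel at the real point a, already known to be
integrable. -/
theorem integral_mul_cesaroAverage {α : ℝ} (hα : 0 < α) {g : ℝ → ℂ}
    (hgm : StronglyMeasurable g) (hg : MemLp g 2 halfLine) {h : ℝ → ℂ} (hh : Measurable h)
    {a C : ℝ} (ha : 0 < a) (hC : ∀ s, 0 < s → ‖h s‖ ≤ C * Real.exp (-(a * s))) :
    Integrable (fun s => h s * cesaroAverage α g s) halfLine ∧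
      ∫ s, h s * cesaroAverage α g s ∂halfLine =
        ∫ r, (∫ v, (v : ℂ)⁻¹ * h (v⁻¹ * r) ∂cesaroMeasure α) * g r ∂halfLine := by
  have hE := cesaroEnergy_lt_top hα
  have hgm' := hgm.measurable
  have hΦ : Integrable (fun p : ℝ × ℝ => (p.1 : ℂ)⁻¹ * h (p.1⁻¹ * p.2) * g p.2)
      ((cesaroMeasure α).prod halfLine) := by
    refine ((integrable_cesaroKernelIntegrand_mul hE (z := (a : ℂ)) (by simpa using ha)
      hg).norm.const_mul C).mono' ?_ ?_
    · exact (by fun_prop : Measurable fun p : ℝ × ℝ =>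
        (p.1 : ℂ)⁻¹ * h (p.1⁻¹ * p.2) * g p.2).aestronglyMeasurable
    · filter_upwards [Measure.quasiMeasurePreserving_fst.ae (ae_cesaroMeasure α),
        Measure.quasiMeasurePreserving_snd.ae (ae_restrict_mem measurableSet_Ioi)] with p h1 h2
      have h2 : 0 < p.2 := h2
      have hv := h1.1
      rw [norm_mul, norm_mul, norm_mul, norm_cesaroKernelIntegrand _ hv, norm_inv,
        Complex.norm_real, Real.norm_of_nonneg hv.le, Complex.ofReal_re, ← mul_assoc]
      refine mul_le_mul_of_nonneg_right ?_ (norm_nonneg _)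
      rw [mul_left_comm]
      refine mul_le_mul_of_nonneg_left ((hC _ (by positivity)).trans (le_of_eq ?_)) (by positivity)
      congr 2
      ring
  have hscale : ∀ v : ℝ, 0 < v → ∀ s : ℝ, h s * g (v * s) =
      (fun r => h (v⁻¹ * r) * g r) (v * s) := fun v hv s => by
    simp only
    rw [inv_mul_cancel_left₀ hv.ne']
  have hΨ : Integrable (fun p : ℝ × ℝ => h p.2 * g (p.1 * p.2))
      ((cesaroMeasure α).prod halfLine) := by
    have hm : AEStronglyMeasurable (fun p : ℝ × ℝ => h p.2 * g (p.1 * p.2))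
        ((cesaroMeasure α).prod halfLine) :=
      (by fun_prop : Measurable fun p : ℝ × ℝ => h p.2 * g (p.1 * p.2)).aestronglyMeasurable
    rw [integrable_prod_iff hΦ.1] at hΦ
    refine (integrable_prod_iff hm).2 ⟨?_, hΦ.2.congr ?_⟩
    · filter_upwards [hΦ.1, ae_cesaroMeasure α] with v h1 hv
      have h2 : Integrable (fun r => h (v⁻¹ * r) * g r) halfLine := by
        refine (h1.const_mul (v : ℂ)).congr (Eventually.of_forall fun r => ?_)
        have : (v : ℂ) ≠ 0 := by exact_mod_cast hv.1.ne'
        simp only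
        field_simp
      simp only [hscale v hv.1]
      refine (integrableOn_Ioi_comp_mul_left_iff (fun r => h (v⁻¹ * r) * g r) 0 hv.1).2 ?_
      rw [mul_zero]
      exact h2
    · filter_upwards [ae_cesaroMeasure α] with v hv
      simp only [hscale v hv.1]
      rw [integral_comp_mul_left_Ioi (fun r => ‖h (v⁻¹ * r) * g r‖) 0 hv.1, mul_zero, smul_eq_mul,
        ← integral_const_mul]
      congr 1 with r
      rw [mul_assoc, norm_mul, norm_inv, Complex.norm_real, Real.norm_of_nonneg hv.1.le]
  have e1 : ∀ s, h s * cesaroAverage α g s = ∫ v, h s * g (v * s) ∂cesaroMeasure α := fun s =>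
    (integral_const_mul _ _).symm
  constructor
  · simp only [e1]
    exact hΨ.integral_prod_right
  · simp only [e1]
    rw [← integral_integral_swap (f := fun v s => h s * g (v * s)) hΨ]
    simp_rw [← integral_mul_const]
    rw [← integral_integral_swap (f := fun (v : ℝ) r => (v : ℂ)⁻¹ * h (v⁻¹ * r) * g r) hΦ]
    refine integral_congr_ae ?_
    filter_upwards [ae_cesaroMeasure α] with v hv
    simp only [hscale v hv.1]
    rw [integral_comp_mul_left_Ioi (fun r => h (v⁻¹ * r) * g r) 0 hv.1, mul_zero,
      ← integral_smul]
    congr 1 with r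
    rw [Complex.real_smul, Complex.ofReal_inv, mul_assoc]

theorem cesaroStar_laplace_eq_laplace_cesaroAverage {α : ℝ} (hα : 0 < α) {g : ℝ → ℂ}
    (hgm : StronglyMeasurable g) (hg : MemLp g 2 halfLine) (z : RightHalfPlane) :
    Integrable (fun s : ℝ => Complex.exp (-(z : ℂ) * s) * cesaroAverage α g s) halfLine ∧
      cesaroStar α (laplaceHalfPlane g) z = laplace (cesaroAverage α g) z := by
  obtain ⟨h1, h2⟩ := integral_mul_cesaroAverage hα hgm hg
    (h := fun s : ℝ => Complex.exp (-(z : ℂ) * s)) (by fun_prop) (C := 1) z.2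
    (fun s _ => by rw [norm_exp_neg_mul, one_mul])
  refine ⟨h1, ?_⟩
  rw [cesaroStar_laplace hα (cesaroEnergy_lt_top hα) hg, laplace, h2]
  congr 1 with r
  congr 1
  unfold cesaroKernel cesaroKernelIntegrand
  congr 1 with v
  congr 2
  push_cast
  ring

/-- On the line Re z = 1 the Laplace transform of q is the Fourier transform of the integrable
function e^{-s} q(s). -/
theorem ae_eq_zero_of_laplace_eq_zero {q : ℝ → ℂ}
    (hq : Integrable (fun s : ℝ => Complex.exp (-(1 : ℂ) * s) * q s) halfLine)
    (h : ∀ z : RightHalfPlane, laplace q z = 0) : q =ᵐ[halfLine] 0 := by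
  set F : ℝ → ℂ := (Set.Ioi (0 : ℝ)).indicator fun s => Complex.exp (-(1 : ℂ) * s) * q s with hF
  have hFi : Integrable F := (integrable_indicator_iff measurableSet_Ioi).2 hq
  have h0 : F =ᵐ[volume] 0 := by
    refine ae_eq_zero_of_fourier_eq_zero hFi fun ξ => ?_
    have hz : 0 < (1 + 2 * Real.pi * ξ * Complex.I : ℂ).re := by simp
    rw [← h ⟨1 + 2 * Real.pi * ξ * Complex.I, hz⟩, laplace]
    simp only [Real.fourier_eq']
    rw [← integral_indicator measurableSet_Ioi]
    congr 1 with s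
    by_cases hs : s ∈ Set.Ioi (0 : ℝ)
    · simp only [hF, hs, Set.indicator_of_mem, smul_eq_mul]
      rw [← mul_assoc, ← Complex.exp_add]
      congr 2
      simp
      ring
    · simp [hF, hs]
  rw [EventuallyEq, ae_restrict_iff' measurableSet_Ioi]
  filter_upwards [h0] with s hs hmem
  rw [hF, Set.indicator_of_mem hmem] at hs
  exact (mul_eq_zero.1 hs).resolve_left (Complex.exp_ne_zero _)

/-- The substitution v = r/(r+u) turns r/v into r+u. The exponent α is chosen so that all powers of
r and r+u cancel, leaving a Gamma integral in u times e^{-xr}. -/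
theorem integral_cesaroMeasure_rpow_mul_exp {α : ℝ} (hα : 0 < α) {x : ℝ} (hx : 0 < x) {r : ℝ}
    (hr : 0 < r) :
    ∫ v : ℝ, (v : ℂ)⁻¹ * ((((v⁻¹ * r) ^ α : ℝ) : ℂ) * Complex.exp (-(x : ℂ) * ((v⁻¹ * r : ℝ) : ℂ)))
      ∂cesaroMeasure α =
      (α * ((1 / (x : ℂ)) ^ (α : ℂ) * Complex.Gamma α)) * Complex.exp (-(x : ℂ) * r) := by
  rw [integral_cesaroMeasure hα, ← image_div_add_Ioi hr, integral_image_eq_integral_abs_deriv_smul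
    measurableSet_Ioi (f' := fun u => -(r / (r + u) ^ 2))]
  · have hG := Complex.integral_cpow_mul_exp_neg_mul_Ioi (a := (α : ℂ)) (r := x) (by simpa using hα)
      hx
    rw [← hG, ← integral_const_mul, ← integral_mul_const]
    refine setIntegral_congr_fun measurableSet_Ioi fun u hu => ?_
    have hu : 0 < u := hu
    have hru : 0 < r + u := by positivity
    have e1 : (r / (r + u))⁻¹ * r = r + u := by field_simp
    have e2 : 1 - r / (r + u) = u / (r + u) := by field_simp; ring
    have e3 : (u : ℂ) ^ ((α : ℂ) - 1) = ((u ^ (α - 1) : ℝ) : ℂ) := by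
      rw [Complex.ofReal_cpow hu.le]
      push_cast
      rfl
    have e4 : Complex.exp (-(x : ℂ) * ((r + u : ℝ) : ℂ)) =
        Complex.exp (-(x : ℂ) * r) * Complex.exp (-(x : ℂ) * u) := by
      rw [← Complex.exp_add]
      congr 1
      push_cast
      ring
    have e5 : r / (r + u) ^ 2 * (α * (u / (r + u)) ^ (α - 1) * ((r / (r + u))⁻¹ * (r + u) ^ α)) =
        α * u ^ (α - 1) := by
      rw [Real.div_rpow hu.le hru.le, Real.rpow_sub_one hru.ne' α]
      have : (r + u) ^ α ≠ 0 := (Real.rpow_pos_of_pos hru α).ne'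
      field_simp
    simp only [cesaroWeight, abs_neg]
    rw [e1, e2, e3, e4, abs_of_pos (by positivity), Complex.real_smul, ← Complex.ofReal_inv]
    have e6 := congrArg (fun t : ℝ => (t : ℂ)) e5
    simp only [Complex.ofReal_mul] at e6 ⊢
    simp only [neg_mul]
    linear_combination (Complex.exp (-((x : ℂ) * r)) * Complex.exp (-((x : ℂ) * u))) * e6
  · intro u hu
    have hu : 0 < u := hu
    have h1 := ((hasDerivAt_id u).const_add r).inv (by simp; positivity : id (r + id u) ≠ 0)
    have h2 := (h1.const_mul r).hasDerivWithinAt (s := Set.Ioi 0)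
    refine (h2.congr_of_eventuallyEq ?_ ?_).congr_deriv ?_
    · exact Eventually.of_forall fun x => by simp [div_eq_mul_inv]
    · simp [div_eq_mul_inv]
    · simp
      ring
  · intro a (ha : 0 < a) b (hb : 0 < b) hab
    simp only at hab
    rw [div_eq_div_iff (by positivity) (by positivity)] at hab
    have := mul_left_cancel₀ hr.ne' hab
    linarith

/-- The vanishing transform makes the average of g vanish a.e. Pairing it with s^α e^{-xs} recovers
L g(x) up to the nonzero factor α Γ(α) x^{-α}. -/
theorem laplace_ofReal_eq_zero_of_cesaroStar_eq_zero {α : ℝ} (hα : 0 < α) {g : ℝ → ℂ}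
    (hgm : StronglyMeasurable g) (hg : MemLp g 2 halfLine)
    (h : ∀ z, cesaroStar α (laplaceHalfPlane g) z = 0) {x : ℝ}
    (hx : 0 < x) : laplace g x = 0 := by
  have hq : cesaroAverage α g =ᵐ[halfLine] 0 := by
    refine ae_eq_zero_of_laplace_eq_zero ?_ fun z => ?_
    · exact (cesaroStar_laplace_eq_laplace_cesaroAverage hα hgm hg ⟨1, by simp⟩).1
    · rw [← (cesaroStar_laplace_eq_laplace_cesaroAverage hα hgm hg z).2, h]
  obtain ⟨-, h2⟩ := integral_mul_cesaroAverage hα hgm hg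
    (h := fun s : ℝ => ((s ^ α : ℝ) : ℂ) * Complex.exp (-(x : ℂ) * s)) (by fun_prop)
    (a := x / 2) (C := (α / (x / 2)) ^ α) (by positivity) (fun s hs => by
      rw [norm_mul, norm_exp_neg_mul, Complex.norm_real, Complex.ofReal_re,
        Real.norm_of_nonneg (Real.rpow_nonneg hs.le α)]
      have h1 := rpow_le_mul_exp (b := x / 2) hα (by positivity) hs.le
      refine (mul_le_mul_of_nonneg_right h1 (Real.exp_pos _).le).trans (le_of_eq ?_)
      rw [mul_assoc, ← Real.exp_add]
      congr 2
      ring)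
  have e1 : ∫ s : ℝ, ((s ^ α : ℝ) : ℂ) * Complex.exp (-(x : ℂ) * s) * cesaroAverage α g s
      ∂halfLine = 0 := by
    refine integral_eq_zero_of_ae ?_
    filter_upwards [hq] with s hs
    rw [hs]
    simp
  rw [e1] at h2
  have e2 : ∫ r, (∫ v : ℝ, (v : ℂ)⁻¹ * ((((v⁻¹ * r) ^ α : ℝ) : ℂ) *
      Complex.exp (-(x : ℂ) * ((v⁻¹ * r : ℝ) : ℂ))) ∂cesaroMeasure α) * g r ∂halfLine =
      (α * ((1 / (x : ℂ)) ^ (α : ℂ) * Complex.Gamma α)) * laplace g x := by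
    rw [laplace, ← integral_const_mul]
    refine setIntegral_congr_fun measurableSet_Ioi fun r hr => ?_
    rw [integral_cesaroMeasure_rpow_mul_exp hα hx hr, mul_assoc]
  rw [e2] at h2
  refine (mul_eq_zero.1 h2.symm).resolve_left ?_
  have hz0 : (x : ℂ) ≠ 0 := by exact_mod_cast hx.ne'
  refine mul_ne_zero (by exact_mod_cast hα.ne') (mul_ne_zero ?_ ?_)
  · rw [Complex.cpow_ne_zero_iff]
    exact Or.inl (one_div_ne_zero hz0)
  · rw [Complex.Gamma_ofReal]
    exact_mod_cast (Real.Gamma_pos_of_pos hα).ne'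

theorem laplace_eq_zero_of_cesaroStar_eq_zero {α : ℝ} (hα : 0 < α) {g : ℝ → ℂ}
    (hgm : StronglyMeasurable g) (hg : MemLp g 2 halfLine)
    (h : ∀ z, cesaroStar α (laplaceHalfPlane g) z = 0) (z : RightHalfPlane) : laplace g z = 0 := by
  have hopen : IsOpen {z : ℂ | 0 < z.re} := isOpen_lt continuous_const Complex.continuous_re
  have hd : DifferentiableOn ℂ (laplace g) {z : ℂ | 0 < z.re} := fun w hw =>
    (differentiableAt_laplace hg hw).differentiableWithinAt
  refine (hd.analyticOnNhd hopen).eqOn_zero_of_preconnected_of_mem_closure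
    (convex_halfSpace_re_gt 0).isPreconnected (z₀ := 1) (by simp) ?_ z.2
  -- The identity theorem needs zeros accumulating at 1 and different from 1; real points suffice.
  have ht : Tendsto (fun n : ℕ => (((1 + 1 / ((n : ℝ) + 1) : ℝ)) : ℂ)) atTop (𝓝 ((1 : ℝ) : ℂ)) :=
    (Complex.continuous_ofReal.tendsto 1).comp
      (by simpa using tendsto_one_div_add_atTop_nhds_zero_nat.const_add (1 : ℝ))
  rw [Complex.ofReal_one] at ht
  refine mem_closure_of_tendsto ht (Eventually.of_forall fun n => ?_)
  have hn : (0 : ℝ) < 1 / ((n : ℝ) + 1) := by positivity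
  refine ⟨laplace_ofReal_eq_zero_of_cesaroStar_eq_zero hα hgm hg h (by linarith), fun h1 => ?_⟩
  have h2 : (1 + 1 / ((n : ℝ) + 1) : ℝ) = 1 := by exact Complex.ofReal_injective h1
  linarith

/-- Injectivity of `C*_α ∘ L` on `L²(0, ∞)`. -/
theorem ae_eq_zero_of_cesaroStar_laplace_eq_zero {α : ℝ} (hα : 0 < α) {g : ℝ → ℂ}
    (hg : MemLp g 2 halfLine) (h : ∀ z, cesaroStar α (laplaceHalfPlane g) z = 0) :
    g =ᵐ[halfLine] 0 := by
  obtain ⟨g', hgm, hae⟩ := hg.1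
  have hg' : MemLp g' 2 halfLine := hg.ae_eq hae
  have e : laplaceHalfPlane g = laplaceHalfPlane g' := by
    unfold laplaceHalfPlane
    rw [laplace_congr_ae hae]
  rw [e] at h
  have h0 : laplaceHalfPlane g' = laplaceHalfPlane 0 := by
    funext z
    rw [laplaceHalfPlane, laplace_eq_zero_of_cesaroStar_eq_zero hα hgm hg' h z]
    simp [laplaceHalfPlane, laplace]
  have h1 := hardyNorm_laplace hg'
  rw [h0, hardyNorm_laplace MemLp.zero, eLpNorm_zero] at h1
  exact hae.trans ((eLpNorm_eq_zero_iff hg'.1 two_ne_zero).1 h1.symm)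


/-! ### The reproducing kernel space and the norm of its kernel -/

/-- The element of `L²(0, ∞)` representing `g ↦ C*_α (L g) (z)`. -/
noncomputable def evalVector {α : ℝ} (hα : 0 < α) (z : RightHalfPlane) : Lp ℂ 2 halfLine :=
  (memLp_cesaroKernel (cesaroEnergy_lt_top hα) z.2).star.toLp

theorem inner_evalVector {α : ℝ} (hα : 0 < α) (z : RightHalfPlane) (g : Lp ℂ 2 halfLine) :
    inner ℂ (evalVector hα z) g = cesaroStar α (laplaceHalfPlane g) z := by
  rw [cesaroStar_laplace hα (cesaroEnergy_lt_top hα) (Lp.memLp g), L2.inner_def]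
  refine integral_congr_ae ?_
  filter_upwards [(memLp_cesaroKernel (cesaroEnergy_lt_top hα) z.2).star.coeFn_toLp] with s hs
  rw [evalVector, hs]
  simp [mul_comm]

theorem norm_evalVector_sq {α : ℝ} (hα : 0 < α) (z : RightHalfPlane) :
    ‖evalVector hα z‖ ^ 2 = (kernelEnergy α z).toReal := by
  have h := eLpNorm_cesaroKernel_sq (cesaroEnergy_lt_top hα) z.2
  rw [evalVector, Lp.norm_toLp, ← ENNReal.toReal_pow, kernelEnergy, ← h]
  congr 2
  refine eLpNorm_congr_norm_ae (Eventually.of_forall fun s => ?_)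
  simp

theorem eq_of_cesaroStar_laplace_eq {α : ℝ} (hα : 0 < α) {g₁ g₂ : Lp ℂ 2 halfLine}
    (h : cesaroStar α (laplaceHalfPlane g₁) = cesaroStar α (laplaceHalfPlane g₂)) : g₁ = g₂ := by
  rw [← sub_eq_zero, Lp.eq_zero_iff_ae_eq_zero]
  refine ae_eq_zero_of_cesaroStar_laplace_eq_zero hα (Lp.memLp _) fun z => ?_
  rw [← inner_evalVector hα, inner_sub_right, inner_evalVector, inner_evalVector, h, sub_self]

theorem exists_Lp_laplace_eq {F : RightHalfPlane → ℂ} (hF : F ∈ hardySpace) :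
    ∃ g : Lp ℂ 2 halfLine, F = laplaceHalfPlane g := by
  obtain ⟨g, hg, rfl⟩ := exists_laplace_eq hF
  refine ⟨hg.toLp, ?_⟩
  unfold laplaceHalfPlane
  rw [laplace_congr_ae hg.coeFn_toLp]

theorem injOn_cesaroStar {α : ℝ} (hα : 0 < α) : Set.InjOn (cesaroStar α) hardySpace := by
  intro F₁ h₁ F₂ h₂ h
  obtain ⟨g₁, rfl⟩ := exists_Lp_laplace_eq h₁
  obtain ⟨g₂, rfl⟩ := exists_Lp_laplace_eq h₂
  rw [eq_of_cesaroStar_laplace_eq hα h]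

theorem hardySobolevNorm_cesaroStar_laplace {α : ℝ} (hα : 0 < α) (g : Lp ℂ 2 halfLine) :
    hardySobolevNorm α (cesaroStar α (laplaceHalfPlane g)) = Real.Gamma (α + 1) * ‖g‖ := by
  rw [hardySobolevNorm, (injOn_cesaroStar hα).leftInvOn_invFunOn
    (laplace_mem_hardySpace (Lp.memLp g)), hardyNorm_laplace (Lp.memLp g), Lp.norm_def]

theorem mem_hardySobolev_iff {α : ℝ} {F : RightHalfPlane → ℂ} :
    F ∈ hardySobolev α ↔ ∃ g : Lp ℂ 2 halfLine, cesaroStar α (laplaceHalfPlane g) = F := by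
  constructor
  · rintro ⟨F, hF, rfl⟩
    obtain ⟨g, rfl⟩ := exists_Lp_laplace_eq hF
    exact ⟨g, rfl⟩
  · rintro ⟨g, rfl⟩
    exact ⟨_, laplace_mem_hardySpace (Lp.memLp g), rfl⟩

/-- The model of `H₂^{(α)}(ℂ⁺)` on `L²(0, ∞)`: `g` stands for the function
`C*_α (L g) / Γ(α + 1)`. -/
noncomputable abbrev lpRKHS {α : ℝ} (hα : 0 < α) : RKHS ℂ (Lp ℂ 2 halfLine) RightHalfPlane ℂ where
  coeCLM := ContinuousLinearMap.pi fun z =>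
    ((Real.Gamma (α + 1))⁻¹ : ℂ) • innerSL ℂ (evalVector hα z)
  coeCLM_injective := by
    intro g₁ g₂ h
    refine eq_of_cesaroStar_laplace_eq hα (funext fun z => ?_)
    have hz := congrFun h z
    have hΓ : ((Real.Gamma (α + 1))⁻¹ : ℂ) ≠ 0 := by
      exact_mod_cast (inv_pos.2 (Real.Gamma_pos_of_pos (by linarith : 0 < α + 1))).ne'
    have h2 : inner ℂ (evalVector hα z) g₁ = inner ℂ (evalVector hα z) g₂ :=
      mul_left_cancel₀ hΓ hz
    rwa [inner_evalVector, inner_evalVector] at h2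

theorem isHardySobolev_lpRKHS {α : ℝ} (hα : 0 < α) :
    @IsHardySobolev α (Lp ℂ 2 halfLine) _ _ (lpRKHS hα) := by
  let _ := lpRKHS hα
  have hΓ : 0 < Real.Gamma (α + 1) := Real.Gamma_pos_of_pos (by linarith)
  have hΓ' : (Real.Gamma (α + 1) : ℂ) ≠ 0 := by exact_mod_cast hΓ.ne'
  have hcoe : ∀ g : Lp ℂ 2 halfLine, (g : RightHalfPlane → ℂ) =
      cesaroStar α (laplaceHalfPlane (((Real.Gamma (α + 1))⁻¹ : ℂ) • g : Lp ℂ 2 halfLine)) := by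
    intro g
    funext z
    rw [← inner_evalVector hα, inner_smul_right]
    rfl
  refine ⟨Set.ext fun F => ?_, fun g => ?_⟩
  · rw [mem_hardySobolev_iff]
    constructor
    · rintro ⟨g, rfl⟩
      exact ⟨_, (hcoe g).symm⟩
    · rintro ⟨g, rfl⟩
      refine ⟨(Real.Gamma (α + 1) : ℂ) • g, ?_⟩
      simp only
      rw [hcoe, smul_smul, inv_mul_cancel₀ hΓ', one_smul]
  · rw [hcoe, hardySobolevNorm_cesaroStar_laplace hα, norm_smul, norm_inv, Complex.norm_real,
      Real.norm_of_nonneg hΓ.le, mul_inv_cancel_left₀ hΓ.ne']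

section Kernel

variable {α : ℝ} {H : Type*} [NormedAddCommGroup H] [InnerProductSpace ℂ H]
  [RKHS ℂ H RightHalfPlane ℂ]

theorem IsHardySobolev.exists_eq_cesaroStar_laplace (h : IsHardySobolev α H) (hα : 0 < α) (f : H) :
    ∃ g : Lp ℂ 2 halfLine, (f : RightHalfPlane → ℂ) = cesaroStar α (laplaceHalfPlane g) ∧
      ‖f‖ = Real.Gamma (α + 1) * ‖g‖ := by
  obtain ⟨g, hg⟩ := mem_hardySobolev_iff.1 (h.range_coe ▸ Set.mem_range_self f)
  exact ⟨g, hg.symm, by rw [h.norm_eq, ← hg, hardySobolevNorm_cesaroStar_laplace hα]⟩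

theorem IsHardySobolev.exists_coe_eq (h : IsHardySobolev α H) (hα : 0 < α) (g : Lp ℂ 2 halfLine) :
    ∃ f : H, (f : RightHalfPlane → ℂ) = cesaroStar α (laplaceHalfPlane g) ∧
      ‖f‖ = Real.Gamma (α + 1) * ‖g‖ := by
  have hm : cesaroStar α (laplaceHalfPlane g) ∈ hardySobolev α := mem_hardySobolev_iff.2 ⟨g, rfl⟩
  rw [← h.range_coe] at hm
  obtain ⟨f, hf⟩ := hm
  simp only at hf
  exact ⟨f, hf, by rw [h.norm_eq, hf, hardySobolevNorm_cesaroStar_laplace hα]⟩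

variable [CompleteSpace H]

theorem inner_kernelAt (z : RightHalfPlane) (f : H) : inner ℂ (kernelAt H z) f = f z := by
  rw [kernelAt, RKHS.kerFun_inner]
  simp

/-- Both vectors represent evaluation at z, on spaces whose norms differ by the factor Γ(α+1).
Comparing norms needs no linear map between the spaces: Cauchy–Schwarz is applied once to the kernel
function itself and once to the function whose preimage is the evaluation vector. -/
theorem IsHardySobolev.norm_kernelAt (h : IsHardySobolev α H) (hα : 0 < α) (z : RightHalfPlane) :
    Real.Gamma (α + 1) * ‖kernelAt H z‖ = ‖evalVector hα z‖ := by
  have hΓ : 0 < Real.Gamma (α + 1) := Real.Gamma_pos_of_pos (by linarith)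
  refine le_antisymm ?_ ?_
  · obtain ⟨g, hg, hn⟩ := h.exists_eq_cesaroStar_laplace hα (kernelAt H z)
    have h1 : ‖kernelAt H z‖ ^ 2 ≤ ‖evalVector hα z‖ * ‖g‖ := by
      have h2 : inner ℂ (kernelAt H z) (kernelAt H z) = inner ℂ (evalVector hα z) g := by
        rw [inner_kernelAt, hg, inner_evalVector]
      have h3 := congrArg norm h2
      rw [inner_self_eq_norm_sq_to_K] at h3
      simp only [norm_pow, Complex.coe_algebraMap, Complex.norm_real, norm_norm] at h3
      exact h3.trans_le (norm_inner_le_norm _ _)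
    rcases (norm_nonneg (kernelAt H z)).eq_or_lt with h0 | h0
    · rw [← h0, mul_zero]
      exact norm_nonneg _
    · refine le_of_mul_le_mul_right ?_ h0
      calc Real.Gamma (α + 1) * ‖kernelAt H z‖ * ‖kernelAt H z‖
          = Real.Gamma (α + 1) * ‖kernelAt H z‖ ^ 2 := by ring
        _ ≤ Real.Gamma (α + 1) * (‖evalVector hα z‖ * ‖g‖) := by gcongr
        _ = ‖evalVector hα z‖ * ‖kernelAt H z‖ := by rw [hn]; ring
  · obtain ⟨f, hf, hn⟩ := h.exists_coe_eq hα (evalVector hα z)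
    have h1 : ‖evalVector hα z‖ ^ 2 ≤ ‖kernelAt H z‖ * ‖f‖ := by
      have h2 : inner ℂ (kernelAt H z) f = inner ℂ (evalVector hα z) (evalVector hα z) := by
        rw [inner_kernelAt, hf, inner_evalVector]
      have h3 := congrArg norm h2
      rw [inner_self_eq_norm_sq_to_K] at h3
      simp only [norm_pow, Complex.coe_algebraMap, Complex.norm_real, norm_norm] at h3
      exact h3.symm.trans_le (norm_inner_le_norm _ _)
    rcases (norm_nonneg (evalVector hα z)).eq_or_lt with h0 | h0
    · rw [← h0]
      positivity
    · refine le_of_mul_le_mul_right ?_ h0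
      calc ‖evalVector hα z‖ * ‖evalVector hα z‖ = ‖evalVector hα z‖ ^ 2 := by ring
        _ ≤ ‖kernelAt H z‖ * ‖f‖ := h1
        _ = Real.Gamma (α + 1) * ‖kernelAt H z‖ * ‖evalVector hα z‖ := by rw [hn]; ring

theorem IsHardySobolev.norm_kernelAt_sq (h : IsHardySobolev α H) (hα : 0 < α)
    (z : RightHalfPlane) :
    ‖kernelAt H z‖ ^ 2 = (kernelEnergy α z).toReal / (α ^ 2 * Real.Gamma α ^ 2) := by
  have hΓ : 0 < Real.Gamma α := Real.Gamma_pos_of_pos hα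
  rw [← norm_evalVector_sq hα, ← h.norm_kernelAt hα, Real.Gamma_add_one hα.ne']
  field_simp

theorem IsHardySobolev.norm_kernelAt_sq_le (h : IsHardySobolev α H) (hα : 0 < α)
    {z : RightHalfPlane} {C : ℝ} (hC : 0 ≤ C) (hz : kernelEnergy α z ≤ ENNReal.ofReal C) :
    ‖kernelAt H z‖ ^ 2 ≤ C / (α ^ 2 * Real.Gamma α ^ 2) := by
  rw [h.norm_kernelAt_sq hα]
  gcongr
  exact ENNReal.toReal_le_of_le_ofReal hC hz

theorem IsHardySobolev.le_norm_kernelAt_sq (h : IsHardySobolev α H) (hα : 0 < α)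
    {z : RightHalfPlane} {c : ℝ} (hz : ENNReal.ofReal c ≤ kernelEnergy α z) :
    c / (α ^ 2 * Real.Gamma α ^ 2) ≤ ‖kernelAt H z‖ ^ 2 := by
  rw [h.norm_kernelAt_sq hα]
  gcongr
  refine (ENNReal.ofReal_le_iff_le_toReal ?_).1 hz
  have h1 := eLpNorm_cesaroKernel_sq (cesaroEnergy_lt_top hα) z.2
  rw [kernelEnergy, ← h1]
  exact ENNReal.pow_ne_top (memLp_cesaroKernel (cesaroEnergy_lt_top hα) z.2).2.ne

end Kernel

/-! ### Passage to the stated constants -/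

theorem norm_pos (z : RightHalfPlane) : 0 < ‖(z : ℂ)‖ :=
  norm_pos_iff.2 fun h => by simpa [h] using z.2

theorem norm_le_sqrt_two_mul_re {z : RightHalfPlane} (h : |Complex.arg (z : ℂ)| ≤ Real.pi / 4) :
    ‖(z : ℂ)‖ ≤ √2 * (z : ℂ).re := by
  have h1 : √2 / 2 ≤ Real.cos (Complex.arg (z : ℂ)) := by
    rw [← Real.cos_pi_div_four, ← Real.cos_abs (Complex.arg (z : ℂ))]
    exact Real.cos_le_cos_of_nonneg_of_le_pi (abs_nonneg _) (by linarith [Real.pi_pos]) h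
  have h2 := Complex.norm_mul_cos_arg (z : ℂ)
  have h3 : √2 * √2 = 2 := Real.mul_self_sqrt (by norm_num)
  have h4 := mul_le_mul_of_nonneg_left h1 (mul_nonneg (Real.sqrt_nonneg 2) z.norm_pos.le)
  have h5 : √2 * ‖(z : ℂ)‖ * (√2 / 2) = ‖(z : ℂ)‖ := by linear_combination ‖(z : ℂ)‖ / 2 * h3
  rw [h5, mul_assoc, h2] at h4
  exact h4

theorem comparable_rpow_of_sq {X : Type*} {N r : X → ℝ} (hN : ∀ x, 0 ≤ N x) (hr : ∀ x, 0 < r x)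
    {c C : ℝ} (hc : 0 < c) (hC : 0 < C)
    (h : ∀ x, c * (1 / r x) ≤ N x ^ 2 ∧ N x ^ 2 ≤ C * (1 / r x)) :
    ∃ c C : ℝ, 0 < c ∧ 0 < C ∧ ∀ x, c * r x ^ (-(1 / 2) : ℝ) ≤ N x ∧
      N x ≤ C * r x ^ (-(1 / 2) : ℝ) := by
  have e : ∀ a : ℝ, 0 ≤ a → ∀ x, √a * r x ^ (-(1 / 2) : ℝ) = √(a * (1 / r x)) := fun a ha x => by
    rw [Real.sqrt_mul ha, Real.rpow_neg (hr x).le, ← Real.sqrt_eq_rpow, one_div, Real.sqrt_inv]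
  refine ⟨√c, √C, Real.sqrt_pos.2 hc, Real.sqrt_pos.2 hC, fun x => ?_⟩
  rw [e c hc.le, e C hC.le]
  exact ⟨Real.sqrt_le_iff.2 ⟨hN x, (h x).1⟩, Real.le_sqrt_of_sq_le (h x).2⟩

end RightHalfPlane

theorem theorem7p2 (α : ℝ) (hα : 0 < α) :
    -- `H₂^{(α)}(ℂ⁺)` is a reproducing kernel Hilbert space
    (∃ (H : Type) (_ : NormedAddCommGroup H) (_ : InnerProductSpace ℂ H) (_ : CompleteSpace H)
        (_ : RKHS ℂ H RightHalfPlane ℂ), RightHalfPlane.IsHardySobolev α H) ∧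
    -- and its kernel satisfies the estimates
    ∀ (H : Type*) [NormedAddCommGroup H] [InnerProductSpace ℂ H] [CompleteSpace H]
      [RKHS ℂ H RightHalfPlane ℂ], RightHalfPlane.IsHardySobolev α H →
      -- (i)
      (1 ≤ α → ∀ z : RightHalfPlane,
        1 / ((2 * α - 1) * Real.Gamma α ^ 2) * (1 / ‖(z : ℂ)‖)
            ≤ ‖RightHalfPlane.kernelAt H z‖ ^ 2 ∧
        ‖RightHalfPlane.kernelAt H z‖ ^ 2
            ≤ Real.pi / (α * Real.Gamma α ^ 2) * (1 / ‖(z : ℂ)‖)) ∧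
      -- (ii)
      (1 / 2 < α → α < 1 → ∀ z : RightHalfPlane,
        1 / Real.Gamma α ^ 2 * (1 / ‖(z : ℂ)‖) ≤ ‖RightHalfPlane.kernelAt H z‖ ^ 2 ∧
        ‖RightHalfPlane.kernelAt H z‖ ^ 2
            ≤ Real.pi / ((2 * α - 1) * Real.Gamma α ^ 2) * (1 / ‖(z : ℂ)‖)) ∧
      -- for `α > 1/2` the norm of the kernel function is comparable to `|z|^{-1/2}`
      (1 / 2 < α → ∃ c C : ℝ, 0 < c ∧ 0 < C ∧ ∀ z : RightHalfPlane,
        c * ‖(z : ℂ)‖ ^ (-(1 / 2) : ℝ) ≤ ‖RightHalfPlane.kernelAt H z‖ ∧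
        ‖RightHalfPlane.kernelAt H z‖ ≤ C * ‖(z : ℂ)‖ ^ (-(1 / 2) : ℝ)) ∧
      -- (iii)
      (α ≤ 1 / 2 → ∀ z : RightHalfPlane,
        1 / Real.Gamma α ^ 2 * (1 / ‖(z : ℂ)‖) ≤ ‖RightHalfPlane.kernelAt H z‖ ^ 2 ∧
        (|Complex.arg (z : ℂ)| ≤ Real.pi / 4 →
          ‖RightHalfPlane.kernelAt H z‖ ^ 2
            ≤ 2 / Real.Gamma (α + 1) ^ 2 * (1 / ‖(z : ℂ)‖)) ∧
        (Real.pi / 4 < |Complex.arg (z : ℂ)| →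
          ‖RightHalfPlane.kernelAt H z‖ ^ 2
            ≤ 2 / Real.Gamma (α + 1) ^ 2 * (1 / (z : ℂ).re))) := by
  have hΓ : 0 < Real.Gamma α := Real.Gamma_pos_of_pos hα
  refine ⟨⟨Lp ℂ 2 halfLine, inferInstance, inferInstance, inferInstance,
    RightHalfPlane.lpRKHS hα, RightHalfPlane.isHardySobolev_lpRKHS hα⟩, ?_⟩
  intro H _ _ _ _ h
  have low1 : 1 ≤ α → ∀ z : RightHalfPlane,
      1 / ((2 * α - 1) * Real.Gamma α ^ 2) * (1 / ‖(z : ℂ)‖)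
        ≤ ‖RightHalfPlane.kernelAt H z‖ ^ 2 := fun h1 z => by
    have hz := z.norm_pos
    have h2 : 0 < 2 * α - 1 := by linarith
    refine le_trans (le_of_eq ?_)
      (h.le_norm_kernelAt_sq hα (RightHalfPlane.le_kernelEnergy_of_one_le h1 z.2))
    field_simp
  have low2 : α ≤ 1 → ∀ z : RightHalfPlane,
      1 / Real.Gamma α ^ 2 * (1 / ‖(z : ℂ)‖) ≤ ‖RightHalfPlane.kernelAt H z‖ ^ 2 := fun h1 z => by
    have hz := z.norm_pos
    refine le_trans (le_of_eq ?_)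
      (h.le_norm_kernelAt_sq hα (RightHalfPlane.le_kernelEnergy_of_le_one hα h1 z.2))
    field_simp
  have up1 : 1 / 2 < α → ∀ z : RightHalfPlane, ‖RightHalfPlane.kernelAt H z‖ ^ 2
      ≤ Real.pi / ((2 * α - 1) * Real.Gamma α ^ 2) * (1 / ‖(z : ℂ)‖) := fun h1 z => by
    have hz := z.norm_pos
    have h2 : 0 < 2 * α - 1 := by linarith
    refine (h.norm_kernelAt_sq_le hα (by positivity)
      (RightHalfPlane.kernelEnergy_le_of_half_lt h1 z.2)).trans (le_of_eq ?_)
    field_simp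
  have up2 : α ≤ 1 → ∀ z : RightHalfPlane, ‖RightHalfPlane.kernelAt H z‖ ^ 2
      ≤ 2 * Real.log 2 / Real.Gamma (α + 1) ^ 2 * (1 / (z : ℂ).re) := fun h1 z => by
    have hz := z.2
    have hlog := Real.log_pos one_lt_two
    refine (h.norm_kernelAt_sq_le hα (by positivity)
      (RightHalfPlane.kernelEnergy_le_of_le_one hα h1 z.2)).trans (le_of_eq ?_)
    rw [Real.Gamma_add_one hα.ne']
    field_simp
  refine ⟨fun h1 z => ⟨low1 h1 z, ?_⟩, fun h1 h2 z => ⟨low2 h2.le z, up1 h1 z⟩, fun h1 => ?_,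
    fun h1 z => ⟨low2 (by linarith) z, fun harg => ?_, fun _ => ?_⟩⟩
  · refine (up1 (by linarith) z).trans ?_
    -- For α ≥ 1 the Schur bound with 2α - 1 is already stronger than the one with α.
    have : α ≤ 2 * α - 1 := by linarith
    gcongr
  · have h2 : 0 < 2 * α - 1 := by linarith
    rcases le_total 1 α with h3 | h3
    · exact RightHalfPlane.comparable_rpow_of_sq (fun _ => norm_nonneg _)
        (fun z => z.norm_pos) (by positivity) (by positivity) fun z => ⟨low1 h3 z, up1 h1 z⟩
    · exact RightHalfPlane.comparable_rpow_of_sq (fun _ => norm_nonneg _)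
        (fun z => z.norm_pos) (by positivity) (by positivity) fun z => ⟨low2 h3 z, up1 h1 z⟩
  · refine (up2 (by linarith) z).trans ?_
    have hz := z.2
    have hn := z.norm_pos
    have h2 := RightHalfPlane.norm_le_sqrt_two_mul_re harg
    have hlog := Real.log_two_lt_d9
    have hlog' := Real.log_pos one_lt_two
    -- Numerically √2 · log 2 ≤ 1.42 · 0.7 < 1, which is what lets Re z be replaced by |z| in the
    -- sector.
    have hs : √2 ≤ 1.42 := Real.sqrt_le_iff.2 (by norm_num)
    have h3 : Real.log 2 * ‖(z : ℂ)‖ ≤ (z : ℂ).re := by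
      calc Real.log 2 * ‖(z : ℂ)‖ ≤ 0.7 * (1.42 * (z : ℂ).re) :=
            mul_le_mul (by linarith) (h2.trans (by gcongr)) hn.le (by norm_num)
        _ ≤ (z : ℂ).re := by linarith
    have h4 : Real.log 2 * (1 / (z : ℂ).re) ≤ 1 / ‖(z : ℂ)‖ := by
      rw [mul_one_div, div_le_div_iff₀ hz hn]
      linarith
    calc 2 * Real.log 2 / Real.Gamma (α + 1) ^ 2 * (1 / (z : ℂ).re)
        = 2 / Real.Gamma (α + 1) ^ 2 * (Real.log 2 * (1 / (z : ℂ).re)) := by ring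
      _ ≤ _ := by gcongr
  · refine (up2 (by linarith) z).trans ?_
    have hz := z.2
    gcongr
    linarith [Real.log_two_lt_d9]
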